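/- Proposition (Endo–Pajitnov manifolds do not admit lcK metrics). Let $n>1$ and let $M\in \mathrm{SL}(2n+1,\mathbb{Z})$ have a real eigenvalue $\alpha>0$, $\alpha\neq 1$, of algebraic multiplicity one, such that all other complex eigenvalues of $M$ are non-real. ($M$ need not be diagonalizable.) Let $a=(a^1,\dots,a^{2n+1})^T\in\mathbb{R}^{2n+1}$ be a non-zero eigenvector of $M$ for $\alpha$, let $W\subset\mathbb{C}^{2n+1}$ be the sum of the generalized eigenspaces of $M$ for the eigenvalues $\beta$ with $\operatorname{Im}\beta>0$ (so $\dim_{\mathbb{C}}W=n$), let $b_1,\dots,b_n$ be a basis of $W$, $b_j=(b_j^1,\dots,b_j^{2n+1})^T$, and let $R\in\mathrm{GL}(n,\mathbb{C})$ be the matrix of $x\mapsto Mx$ on $W$ in this basis. Let $G_M$ be the group of automorphisms of $\mathbb{H}\times\mathbb{C}^n$ ($\mathbb{H}$ being the upper half-plane) generated by $$g_0(w,z)=(\alpha w,R^Tz),\qquad g_i(w,z)=(w,z)+(a^i,b_1^i,\dots,b_n^i),\quad 1\le i\le 2n+1 .$$ It acts freely and properly discontinuously; let $T_M=G_M\backslash(\mathbb{H}\times\mathbb{C}^n)$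 be the quotient complex manifold, of complex dimension $n+1$ (an Endo–Pajitnov manifold). Then $T_M$ admits no locally conformally Kähler metric: there is no smooth Hermitian metric $g$ on $T_M$ such that $T_M$ is covered by open sets $U$ carrying smooth functions $f\colon U\to\mathbb{R}$ for which $e^{-f}g$ is Kähler on $U$ (i.e. the fundamental form $\omega(X,Y)=g(JX,Y)$ satisfies $d(e^{-f}\omega)=0$ on $U$). -/

import Mathlib

open scoped Manifold ContDiff Topology Matrix UpperHalfPlane

noncomputable section

/-! ### Hermitian and locally conformally Kähler metrics on complex manifolds -/

section ComplexManifolds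

variable {E : Type*} [NormedAddCommGroup E] [NormedSpace ℂ E]
  {X : Type*} [TopologicalSpace X] [ChartedSpace E X]

/-- The smooth (even real analytic) manifold underlying a complex manifold. -/
instance ComplexManifold.isManifold_real [IsManifold 𝓘(ℂ, E) ω X] : IsManifold 𝓘(ℝ, E) ω X := by
  refine isManifold_of_contDiffOn 𝓘(ℝ, E) ω X fun e e' he he' ↦ ?_
  have h := (contDiffGroupoid ω 𝓘(ℂ, E)).compatible he he'
  rw [contDiffGroupoid, mem_groupoid_of_pregroupoid] at h
  have h' : ContDiffOn ℂ ω (𝓘(ℂ, E) ∘ (e.symm ≫ₕ e') ∘ 𝓘(ℂ, E).symm)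
      (𝓘(ℂ, E).symm ⁻¹' (e.symm ≫ₕ e').source ∩ Set.range 𝓘(ℂ, E)) := h.1
  simpa using h'.restrict_scalars ℝ

variable (E) in
/-- The complex structure `J` on the real tangent space of a complex manifold at `x`. The tangent
space at `x` is a copy of the model space `E`, through the preferred chart at `x`; changes of charts
being holomorphic, multiplication by `i` does not depend on the chart. -/
def complexStructure (x : X) :
    TangentSpace 𝓘(ℝ, E) x →L[ℝ] TangentSpace 𝓘(ℝ, E) x :=
  (Complex.I • ContinuousLinearMap.id ℝ E : E →L[ℝ] E)

/-- The differential form `η` of degree `k`, read in the chart `e`, i.e. the pullback of `η`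
by `e⁻¹`, as a differential form on the model space (meaningful on `e.target`). -/
def formInChart {k : ℕ}
    (η : ∀ x : X, TangentSpace 𝓘(ℝ, E) x [⋀^Fin k]→L[ℝ] ℝ) (e : OpenPartialHomeomorph X E)
    (y : E) : E [⋀^Fin k]→L[ℝ] ℝ :=
  (η (e.symm y)).compContinuousLinearMap
    (mfderiv 𝓘(ℝ, E) 𝓘(ℝ, E) e.symm y : E →L[ℝ] TangentSpace 𝓘(ℝ, E) (e.symm y))

/-- `dη = 0` on the open set `U`: the exterior derivative of `η` vanishes on `U` in every chart. -/
def IsClosedFormOn {k : ℕ} (η : ∀ x : X, TangentSpace 𝓘(ℝ, E) x [⋀^Fin k]→L[ℝ] ℝ)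
    (U : Set X) : Prop :=
  ∀ e ∈ atlas E X, ∀ y ∈ e.target, e.symm y ∈ U → extDeriv (formInChart η e) y = 0

variable (E X) in
/-- A (smooth) Hermitian metric on the complex manifold `X`: a smooth Riemannian metric for which
the complex structure `J` is an isometry. -/
structure HermitianMetric [IsManifold 𝓘(ℂ, E) ω X] extends
    Bundle.ContMDiffRiemannianMetric 𝓘(ℝ, E) ∞ E (TangentSpace 𝓘(ℝ, E) : X → Type _) where
  inner_J (x : X) (v w : TangentSpace 𝓘(ℝ, E) x) :
    inner x (complexStructure E x v) (complexStructure E x w) = inner x v w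

variable [IsManifold 𝓘(ℂ, E) ω X]

/-- The fundamental form `ω(v, w) = g(Jv, w)` of a Hermitian metric `g`. -/
def HermitianMetric.fundamentalForm (g : HermitianMetric E X) (x : X) :
    TangentSpace 𝓘(ℝ, E) x [⋀^Fin 2]→L[ℝ] ℝ where
  toFun v := g.inner x (complexStructure E x (v 0)) (v 1)
  map_update_add' v i y z := by
    fin_cases i <;> simp [Function.update]
  map_update_smul' v i c y := by
    fin_cases i <;> simp [Function.update]
  map_eq_zero_of_eq' v i j hv hij := by
    have h01 : v 0 = v 1 := by
      fin_cases i <;> fin_cases j <;> simp_all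
    have hJ := g.inner_J x (complexStructure E x (v 0)) (v 0)
    have hJJ : complexStructure E x (complexStructure E x (v 0)) = -v 0 := by
      have key (e : E) : Complex.I • Complex.I • e = -e := by
        rw [smul_smul, Complex.I_mul_I, neg_one_smul]
      exact key (v 0)
    rw [hJJ, map_neg, neg_apply,
      g.symm x (v 0) (complexStructure E x (v 0))] at hJ
    rw [← h01]
    linarith
  cont := by
    have key (B : E →L[ℝ] E →L[ℝ] ℝ) (J : E →L[ℝ] E) :
        Continuous fun v : Fin 2 → E ↦ B (J (v 0)) (v 1) := by fun_prop
    exact key (g.inner x) (complexStructure E x)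

/-- A Hermitian metric `g` is locally conformally Kähler if `X` is covered by open sets `U` with
smooth functions `f` on `U` such that the metric `e^{-f} g` is Kähler on `U`, that is, its
fundamental form `e^{-f} ω` is closed on `U`. -/
def HermitianMetric.IsLocallyConformallyKahler (g : HermitianMetric E X) : Prop :=
  ∀ p : X, ∃ U : Set X, IsOpen U ∧ p ∈ U ∧ ∃ f : X → ℝ, ContMDiffOn 𝓘(ℝ, E) 𝓘(ℝ, ℝ) ∞ f U ∧
    IsClosedFormOn (fun x ↦ Real.exp (-f x) • g.fundamentalForm x) U

end ComplexManifolds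

/-! ### Endo–Pajitnov manifolds -/

/-- The endomorphism of `ℂ^m` given by multiplication with the integer matrix `M`. -/
def complexMul {m : ℕ} (M : Matrix.SpecialLinearGroup (Fin m) ℤ) :
    Module.End ℂ (Fin m → ℂ) :=
  Matrix.toLin' (M.1.map (Int.cast : ℤ → ℂ))

/-- The sum `W` of the generalized eigenspaces `W(β)` of `M` over all eigenvalues `β` with
`Im β > 0` (if `β` is not an eigenvalue, its generalized eigenspace is zero). -/
def upperEigenspace {m : ℕ} (M : Matrix.SpecialLinearGroup (Fin m) ℤ) :
    Submodule ℂ (Fin m → ℂ) :=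
  ⨆ β : {β : ℂ // 0 < β.im}, (complexMul M).maxGenEigenspace β

lemma complexMul_mem_upperEigenspace {m : ℕ} (M : Matrix.SpecialLinearGroup (Fin m) ℤ)
    (x : Fin m → ℂ) (hx : x ∈ upperEigenspace M) : complexMul M x ∈ upperEigenspace M := by
  have h : upperEigenspace M ≤ (upperEigenspace M).comap (complexMul M) := by
    refine iSup_le fun β y hy ↦ ?_
    exact Submodule.mem_iSup_of_mem β
      (Module.End.mapsTo_maxGenEigenspace_of_comm (Commute.refl (complexMul M)) _ hy)
  exact h hx

/-- The restriction `f_M : W → W` of the multiplication with `M`. -/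
def restrictUpper {m : ℕ} (M : Matrix.SpecialLinearGroup (Fin m) ℤ) :
    upperEigenspace M →ₗ[ℂ] upperEigenspace M :=
  (complexMul M).restrict (complexMul_mem_upperEigenspace M)

/-- The data from which an Endo–Pajitnov manifold of complex dimension `n + 1` is built:
a matrix `M ∈ SL(2n+1, ℤ)` with a simple real eigenvalue `α > 0`, `α ≠ 1`, and all other complex
eigenvalues non-real, a real eigenvector `a` for `α`, and a basis `b` of `W`. -/
structure EndoPajitnovData (n : ℕ) where
  M : Matrix.SpecialLinearGroup (Fin (2 * n + 1)) ℤ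
  α : ℝ
  α_pos : 0 < α
  α_ne_one : α ≠ 1
  α_simple : (LinearMap.charpoly (complexMul M)).rootMultiplicity (α : ℂ) = 1
  im_ne_zero : ∀ β : ℂ, (complexMul M).HasEigenvalue β → β ≠ (α : ℂ) → β.im ≠ 0
  a : Fin (2 * n + 1) → ℝ
  a_ne_zero : a ≠ 0
  mul_a : (M.1.map (Int.cast : ℤ → ℝ)) *ᵥ a = α • a
  b : Module.Basis (Fin n) ℂ (upperEigenspace M)

namespace EndoPajitnovData

variable {n : ℕ} (D : EndoPajitnovData n)

/-- The matrix `R` of `f_M` in the basis `b`. -/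
def R : Matrix (Fin n) (Fin n) ℂ := LinearMap.toMatrix D.b D.b (restrictUpper D.M)

lemma isUnit_R : IsUnit D.R.det := by
  have hinj : Function.Injective (restrictUpper D.M) := by
    intro x y hxy
    have hdet : (D.M.1.map (Int.cast : ℤ → ℂ)).det = 1 := by
      have := (Int.castRingHom ℂ).map_det D.M.1
      rw [D.M.2] at this
      simpa using this.symm
    have h1 : (D.M.1.map (Int.cast : ℤ → ℂ)) *ᵥ x.1 = (D.M.1.map (Int.cast : ℤ → ℂ)) *ᵥ y.1 :=
      congrArg Subtype.val hxy
    exact Subtype.ext (Matrix.mulVec_injective_of_isUnit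
      ((Matrix.isUnit_iff_isUnit_det _).2 (by rw [hdet]; exact isUnit_one)) h1)
  have := LinearEquiv.isUnit_det (LinearEquiv.ofInjectiveEndo _ hinj) D.b D.b
  exact this

lemma isUnit_RT : IsUnit D.Rᵀ.det := by
  rw [Matrix.det_transpose]; exact D.isUnit_R

/-- The automorphism `g₀(w, z) = (α w, Rᵀ z)` of `ℍ × ℂⁿ`. -/
def g₀ : Equiv.Perm (ℍ × (Fin n → ℂ)) where
  toFun p := ((⟨D.α, D.α_pos⟩ : {x : ℝ // 0 < x}) • p.1, D.Rᵀ *ᵥ p.2)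
  invFun p := ((⟨D.α⁻¹, inv_pos.2 D.α_pos⟩ : {x : ℝ // 0 < x}) • p.1, D.Rᵀ⁻¹ *ᵥ p.2)
  left_inv p := by
    refine Prod.ext (UpperHalfPlane.ext ?_) ?_
    · simp [D.α_pos.ne']
    · simp [Matrix.nonsing_inv_mul _ D.isUnit_RT]
  right_inv p := by
    refine Prod.ext (UpperHalfPlane.ext ?_) ?_
    · simp [D.α_pos.ne']
    · simp [Matrix.mul_nonsing_inv _ D.isUnit_RT]

/-- The translation of `ℍ × ℂⁿ` by a vector of `ℝ × ℂⁿ`. -/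
def translation (v : ℝ × (Fin n → ℂ)) : Equiv.Perm (ℍ × (Fin n → ℂ)) where
  toFun p := (v.1 +ᵥ p.1, p.2 + v.2)
  invFun p := (-v.1 +ᵥ p.1, p.2 - v.2)
  left_inv p := by simp
  right_inv p := by simp

/-- The vectors `u_i = (a^i, b_1^i, …, b_n^i)`, where `i = 1, …, 2n + 1`. -/
def u (i : Fin (2 * n + 1)) : ℝ × (Fin n → ℂ) := (D.a i, fun j ↦ (D.b j).1 i)

/-- The automorphism `g_i(w, z) = (w, z) + u_i` of `ℍ × ℂⁿ`, where `i = 1, …, 2n + 1`. -/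
def g (i : Fin (2 * n + 1)) : Equiv.Perm (ℍ × (Fin n → ℂ)) := translation (D.u i)

/-- The group `G_M` of automorphisms of `ℍ × ℂⁿ` generated by `g₀, g_1, …, g_{2n+1}`. -/
def G : Subgroup (Equiv.Perm (ℍ × (Fin n → ℂ))) :=
  Subgroup.closure (insert D.g₀ (Set.range D.g))

/-! #### The action of `G_M` is free and properly discontinuous -/

/-- The vector `∑ c_i u_i`. -/
def latticeVec : (Fin (2 * n + 1) → ℝ) →ₗ[ℝ] ℝ × (Fin n → ℂ) :=
  Fintype.linearCombination ℝ D.u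

lemma latticeVec_fst (c : Fin (2 * n + 1) → ℝ) : (D.latticeVec c).1 = ∑ i, c i * D.a i := by
  simp [latticeVec, Fintype.linearCombination_apply, u, Prod.fst_sum]

lemma latticeVec_snd (c : Fin (2 * n + 1) → ℝ) (j : Fin n) :
    (D.latticeVec c).2 j = ∑ i, (c i : ℂ) * (D.b j).1 i := by
  simp [latticeVec, Fintype.linearCombination_apply, u, Prod.snd_sum]

lemma maxGenEigenspace_conj {m : ℕ} (M : Matrix.SpecialLinearGroup (Fin m) ℤ) (β : ℂ)
    (x : Fin m → ℂ) (hx : x ∈ (complexMul M).maxGenEigenspace β) :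
    star x ∈ (complexMul M).maxGenEigenspace (star β) := by
  rw [Module.End.mem_maxGenEigenspace] at hx ⊢
  obtain ⟨k, hk⟩ := hx
  refine ⟨k, ?_⟩
  have h1 : ∀ y, (complexMul M - star β • 1) (star y) = star ((complexMul M - β • 1) y) := by
    intro y
    ext i
    simp [complexMul, Matrix.mulVec, dotProduct]
  have h2 : ∀ k : ℕ, ∀ y, ((complexMul M - star β • 1) ^ k) (star y) =
      star (((complexMul M - β • 1) ^ k) y) := by
    intro k
    induction k with
    | zero => intro y; simp
    | succ k ih => intro y; rw [pow_succ, pow_succ, Module.End.mul_apply, h1, ih]; rfl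
  rw [h2, hk, star_zero]

/-- The vectors `u_i` are linearly independent over `ℝ`. -/
lemma latticeVec_injective : Function.Injective D.latticeVec := by
  rw [← LinearMap.ker_eq_bot, LinearMap.ker_eq_bot']
  intro c hc
  let φ : (Fin (2 * n + 1) → ℂ) →ₗ[ℂ] ℂ := Fintype.linearCombination ℂ (fun i ↦ (c i : ℂ))
  have hφ : ∀ x, φ x = ∑ i, x i * c i := fun x ↦ by
    simp [φ, Fintype.linearCombination_apply]
  have hφstar : ∀ x, φ (star x) = star (φ x) := fun x ↦ by simp [hφ]
  have hW : upperEigenspace D.M ≤ LinearMap.ker φ := by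
    intro x hx
    have hb : ∀ j, φ (D.b j).1 = 0 := fun j ↦ by
      have := congrFun (congrArg Prod.snd hc) j
      rw [latticeVec_snd] at this
      rw [hφ]
      refine Eq.trans ?_ this
      exact Finset.sum_congr rfl fun i _ ↦ mul_comm _ _
    have : φ ∘ₗ (upperEigenspace D.M).subtype = 0 := D.b.ext fun j ↦ by simpa using hb j
    exact LinearMap.congr_fun this ⟨x, hx⟩
  have ha : φ (fun i ↦ (D.a i : ℂ)) = 0 := by
    have := congrArg Prod.fst hc
    rw [latticeVec_fst] at this
    rw [hφ]
    have h2 : ((∑ i, c i * D.a i : ℝ) : ℂ) = 0 := by rw [this]; simp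
    push_cast at h2
    rw [← h2]
    exact Finset.sum_congr rfl fun i _ ↦ mul_comm _ _
  have htop : (⊤ : Submodule ℂ (Fin (2 * n + 1) → ℂ)) ≤ LinearMap.ker φ := by
    rw [← Module.End.iSup_maxGenEigenspace_eq_top (complexMul D.M)]
    refine iSup_le fun β ↦ ?_
    rcases lt_trichotomy β.im 0 with h | h | h
    · intro x hx
      have h1 := maxGenEigenspace_conj D.M β x hx
      have h2 : star x ∈ upperEigenspace D.M :=
        Submodule.mem_iSup_of_mem (p := fun β : {β : ℂ // 0 < β.im} ↦
          (complexMul D.M).maxGenEigenspace β) ⟨star β, by simpa using h⟩ h1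
      have h3 := hW h2
      rw [LinearMap.mem_ker, hφstar, star_eq_zero] at h3
      exact h3
    · by_cases hβ : β = D.α
      · subst hβ
        have hdim : Module.finrank ℂ ((complexMul D.M).maxGenEigenspace (D.α : ℂ)) = 1 := by
          rw [LinearMap.finrank_maxGenEigenspace_eq, D.α_simple]
        have hmem : (fun i ↦ (D.a i : ℂ)) ∈ (complexMul D.M).maxGenEigenspace (D.α : ℂ) := by
          rw [Module.End.mem_maxGenEigenspace]
          refine ⟨1, ?_⟩
          ext i
          have := congrArg (fun r : ℝ ↦ (r : ℂ)) (congrFun D.mul_a i)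
          simp [Matrix.mulVec, dotProduct] at this
          simp [complexMul, Matrix.mulVec, dotProduct, this]
        have hne : (⟨_, hmem⟩ : (complexMul D.M).maxGenEigenspace (D.α : ℂ)) ≠ 0 := by
          intro h0
          apply D.a_ne_zero
          ext i
          have := congrFun (congrArg Subtype.val h0) i
          simpa using this
        intro x hx
        obtain ⟨r, hr⟩ := exists_smul_eq_of_finrank_eq_one hdim hne ⟨x, hx⟩
        have hr' : r • (fun i ↦ (D.a i : ℂ)) = x := congrArg Subtype.val hr
        rw [LinearMap.mem_ker, ← hr', map_smul, ha, smul_zero]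
      · have hnot : ¬ (complexMul D.M).HasEigenvalue β := fun h' ↦ D.im_ne_zero β h' hβ h
        have : (complexMul D.M).maxGenEigenspace β = ⊥ := by
          rw [← Submodule.finrank_eq_zero (R := ℂ), LinearMap.finrank_maxGenEigenspace_eq]
          refine Polynomial.rootMultiplicity_eq_zero fun hroot ↦ hnot ?_
          exact (Module.End.hasEigenvalue_iff_isRoot_charpoly _ _).2 hroot
        rw [this]
        exact bot_le
    · exact le_trans (le_iSup (fun β : {β : ℂ // 0 < β.im} ↦
          (complexMul D.M).maxGenEigenspace (β : ℂ)) ⟨β, h⟩) hW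
  ext i
  have := htop (Submodule.mem_top (x := Pi.single i (1 : ℂ)))
  rw [LinearMap.mem_ker, hφ] at this
  simpa [Pi.single_apply] using this

lemma translation_add (v v' : ℝ × (Fin n → ℂ)) :
    translation (v + v') = translation v * translation v' := by
  ext p : 1
  refine Prod.ext ?_ ?_
  · exact add_vadd v.1 v'.1 p.1
  · change p.2 + (v.2 + v'.2) = p.2 + v'.2 + v.2
    abel

lemma translation_zero : translation (0 : ℝ × (Fin n → ℂ)) = 1 := by
  ext p : 1
  exact Prod.ext (zero_vadd _ _) (add_zero _)

/-- The vector `∑ c_i u_i` with integer coefficients `c_i`. -/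
def intVec (c : Fin (2 * n + 1) → ℤ) : ℝ × (Fin n → ℂ) := D.latticeVec fun i ↦ (c i : ℝ)

lemma intVec_add (c c' : Fin (2 * n + 1) → ℤ) : D.intVec (c + c') = D.intVec c + D.intVec c' := by
  rw [intVec, intVec, intVec, ← map_add]
  congr 1
  ext i
  simp

lemma intVec_neg (c : Fin (2 * n + 1) → ℤ) : D.intVec (-c) = -D.intVec c := by
  rw [intVec, intVec, ← map_neg]
  congr 1
  ext i
  simp

lemma intVec_single (i : Fin (2 * n + 1)) : D.intVec (Pi.single i 1) = D.u i := by
  have : (fun j ↦ ((Pi.single i 1 : Fin (2 * n + 1) → ℤ) j : ℝ)) = Pi.single i 1 := by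
    ext j
    by_cases h : j = i
    · subst h; simp
    · simp [h]
  rw [intVec, this, latticeVec]
  simp

lemma mulVec_b (j : Fin n) (i : Fin (2 * n + 1)) :
    ∑ l, D.R l j * (D.b l).1 i = ∑ l, (D.M.1 i l : ℂ) * (D.b j).1 l := by
  have h1 := D.b.sum_repr (restrictUpper D.M (D.b j))
  have h2 := congrFun (congrArg Subtype.val h1) i
  have h3 : (restrictUpper D.M (D.b j)).1 i = ∑ l, (D.M.1 i l : ℂ) * (D.b j).1 l := by
    change (complexMul D.M (D.b j).1) i = _
    simp [complexMul, Matrix.mulVec, dotProduct]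
  rw [← h3, ← h2]
  simp only [R, LinearMap.toMatrix_apply, Submodule.coe_sum, Submodule.coe_smul, Finset.sum_apply,
    Pi.smul_apply, smul_eq_mul]

lemma g₀_mul_translation (c : Fin (2 * n + 1) → ℤ) :
    D.g₀ * translation (D.intVec c) = translation (D.intVec (c ᵥ* D.M.1)) * D.g₀ := by
  ext p : 1
  refine Prod.ext (UpperHalfPlane.ext ?_) ?_
  · have key : D.α * (D.intVec c).1 = (D.intVec (c ᵥ* D.M.1)).1 := by
      have ha : ∀ i, D.α * D.a i = ∑ l, (D.M.1 i l : ℝ) * D.a l := fun i ↦ by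
        have := congrFun D.mul_a i
        simp [Matrix.mulVec, dotProduct] at this
        exact this.symm
      simp only [intVec, latticeVec_fst, Finset.mul_sum, Matrix.vecMul, dotProduct, Int.cast_sum,
        Int.cast_mul, Finset.sum_mul]
      rw [Finset.sum_comm]
      refine Finset.sum_congr rfl fun i _ ↦ ?_
      rw [mul_left_comm, ha, Finset.mul_sum]
      exact Finset.sum_congr rfl fun l _ ↦ by ring
    have key' := congrArg (fun r : ℝ ↦ (r : ℂ)) key
    simp only [Complex.ofReal_mul] at key'
    simp [g₀, translation, key']
  · have key : D.Rᵀ *ᵥ (D.intVec c).2 = (D.intVec (c ᵥ* D.M.1)).2 := by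
      ext j
      simp only [Matrix.mulVec, dotProduct, Matrix.transpose_apply, intVec, latticeVec_snd,
        Matrix.vecMul, Finset.mul_sum, Int.cast_sum, Int.cast_mul, Finset.sum_mul,
        Complex.ofReal_intCast, Complex.ofReal_sum, Complex.ofReal_mul]
      rw [Finset.sum_comm]
      rw [Finset.sum_comm (f := fun x i ↦ (c i : ℂ) * (D.M.1 i x : ℂ) * (D.b j).1 x)]
      refine Finset.sum_congr rfl fun i _ ↦ ?_
      have := congrArg (fun r ↦ (c i : ℂ) * r) (D.mulVec_b j i)
      simp only [Finset.mul_sum] at this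
      convert this using 2 <;> ring
    simp [g₀, translation, Matrix.mulVec_add, key]

lemma g₀_inv_mul_translation (c : Fin (2 * n + 1) → ℤ) :
    D.g₀⁻¹ * translation (D.intVec c) =
      translation (D.intVec (c ᵥ* (D.M⁻¹).1)) * D.g₀⁻¹ := by
  have h := D.g₀_mul_translation (c ᵥ* (D.M⁻¹).1)
  have h2 : (c ᵥ* (D.M⁻¹).1) ᵥ* D.M.1 = c := by
    rw [Matrix.vecMul_vecMul, ← Matrix.SpecialLinearGroup.coe_mul, inv_mul_cancel,
      Matrix.SpecialLinearGroup.coe_one, Matrix.vecMul_one]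
  rw [h2] at h
  rw [inv_mul_eq_iff_eq_mul, ← mul_assoc, h, mul_assoc, mul_inv_cancel, mul_one]

/-- Normal form of the elements of `G_M`. -/
lemma exists_normalForm {γ : Equiv.Perm (ℍ × (Fin n → ℂ))} (hγ : γ ∈ D.G) :
    ∃ (k : ℤ) (c : Fin (2 * n + 1) → ℤ), γ = translation (D.intVec c) * D.g₀ ^ k := by
  induction hγ using Subgroup.closure_induction_left with
  | one => exact ⟨0, 0, by simp [intVec, translation_zero, ← Pi.zero_def]⟩
  | mul_left x hx y _ ih =>
    obtain ⟨k, c, rfl⟩ := ih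
    rcases hx with rfl | ⟨i, rfl⟩
    · refine ⟨1 + k, c ᵥ* D.M.1, ?_⟩
      rw [← mul_assoc, g₀_mul_translation, mul_assoc, zpow_one_add]
    · refine ⟨k, Pi.single i 1 + c, ?_⟩
      rw [intVec_add, intVec_single, translation_add, mul_assoc]
      rfl
  | inv_mul_cancel x hx y _ ih =>
    obtain ⟨k, c, rfl⟩ := ih
    rcases hx with rfl | ⟨i, rfl⟩
    · refine ⟨-1 + k, c ᵥ* (D.M⁻¹).1, ?_⟩
      rw [← mul_assoc, g₀_inv_mul_translation, mul_assoc, zpow_add, zpow_neg_one]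
    · refine ⟨k, -Pi.single i 1 + c, ?_⟩
      rw [inv_mul_eq_iff_eq_mul, ← mul_assoc]
      congr 1
      rw [g, ← intVec_single, ← translation_add, ← intVec_add]
      simp

lemma im_g₀_zpow (k : ℤ) (p : ℍ × (Fin n → ℂ)) : ((D.g₀ ^ k) p).1.im = D.α ^ k * p.1.im := by
  induction k generalizing p with
  | zero => simp
  | succ k ih =>
    rw [zpow_add_one, Equiv.Perm.mul_apply, ih, zpow_add_one₀ D.α_pos.ne']
    simp [g₀, mul_assoc]
  | pred k ih =>
    rw [zpow_sub_one, Equiv.Perm.mul_apply, ih, zpow_sub_one₀ D.α_pos.ne', mul_assoc]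
    congr 1
    exact UpperHalfPlane.pos_real_im _ _

lemma im_normalForm (k : ℤ) (c : Fin (2 * n + 1) → ℤ) (p : ℍ × (Fin n → ℂ)) :
    ((translation (D.intVec c) * D.g₀ ^ k) p).1.im = D.α ^ k * p.1.im := by
  rw [← im_g₀_zpow]
  exact UpperHalfPlane.vadd_im _ _

lemma intVec_injective : Function.Injective D.intVec := fun c c' h ↦ by
  have := D.latticeVec_injective h
  ext i
  have := congrFun this i
  exact_mod_cast this

lemma continuous_translation (v : ℝ × (Fin n → ℂ)) : Continuous (translation v) := by
  refine Continuous.prodMk ?_ (by fun_prop)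
  rw [UpperHalfPlane.isEmbedding_coe.continuous_iff]
  change Continuous fun p : ℍ × (Fin n → ℂ) ↦ (v.1 : ℂ) + (p.1 : ℂ)
  exact continuous_const.add (UpperHalfPlane.continuous_coe.comp continuous_fst)

lemma continuous_smul_mulVec (r : {x : ℝ // 0 < x}) (A : Matrix (Fin n) (Fin n) ℂ) :
    Continuous fun p : ℍ × (Fin n → ℂ) ↦ (r • p.1, A *ᵥ p.2) := by
  refine Continuous.prodMk ?_
    (Continuous.matrix_mulVec (A := fun _ ↦ A) (B := fun p : ℍ × (Fin n → ℂ) ↦ p.2)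
      continuous_const continuous_snd)
  rw [UpperHalfPlane.isEmbedding_coe.continuous_iff]
  change Continuous fun p : ℍ × (Fin n → ℂ) ↦ (r : ℝ) • (p.1 : ℂ)
  have h : Continuous fun p : ℍ × (Fin n → ℂ) ↦ (p.1 : ℂ) :=
    UpperHalfPlane.continuous_coe.comp continuous_fst
  exact h.const_smul (r : ℝ)

lemma continuous_g₀_zpow (k : ℤ) : Continuous ⇑(D.g₀ ^ k) := by
  induction k with
  | zero =>
    rw [zpow_zero]
    exact (continuous_id : Continuous (id : ℍ × (Fin n → ℂ) → ℍ × (Fin n → ℂ)))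
  | succ k ih =>
    rw [zpow_add_one]
    exact ih.comp (continuous_smul_mulVec _ _)
  | pred k ih =>
    rw [zpow_sub_one]
    exact ih.comp (continuous_smul_mulVec _ _)

instance continuousConstSMul_G : ContinuousConstSMul D.G (ℍ × (Fin n → ℂ)) where
  continuous_const_smul γ := by
    obtain ⟨k, c, h⟩ := D.exists_normalForm γ.2
    change Continuous (γ : Equiv.Perm (ℍ × (Fin n → ℂ)))
    rw [h]
    exact (continuous_translation _).comp (D.continuous_g₀_zpow k)

instance isCancelSMul_G : IsCancelSMul D.G (ℍ × (Fin n → ℂ)) := by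
  rw [isCancelSMul_iff_eq_one_of_smul_eq]
  intro γ p hp
  obtain ⟨k, c, h⟩ := D.exists_normalForm γ.2
  have hp' : (translation (D.intVec c) * D.g₀ ^ k) p = p := by rw [← h]; exact hp
  have him := D.im_normalForm k c p
  rw [hp'] at him
  have hk : k = 0 := by
    have h1 : D.α ^ k = 1 := by
      have := p.1.im_pos.ne'
      field_simp at him
      exact him.symm
    exact (zpow_eq_one_iff_right₀ D.α_pos.le D.α_ne_one).1 h1
  subst hk
  have hv : D.intVec c = 0 := by
    refine Prod.ext ?_ ?_
    · have := congrArg (fun q : ℍ × (Fin n → ℂ) ↦ q.1.re) hp'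
      simpa [translation] using this
    · have := congrArg (fun q : ℍ × (Fin n → ℂ) ↦ q.2) hp'
      simpa [translation] using this
  apply Subtype.ext
  rw [h, hv, translation_zero]
  simp

instance properlyDiscontinuousSMul_G : ProperlyDiscontinuousSMul D.G (ℍ × (Fin n → ℂ)) where
  finite_disjoint_inter_image {K L} hK hL := by
    let ψ : ℤ × (Fin (2 * n + 1) → ℤ) → Equiv.Perm (ℍ × (Fin n → ℂ)) := fun x ↦
      translation (D.intVec x.2) * D.g₀ ^ x.1
    suffices hfin : {x | ∃ p ∈ K, ψ x p ∈ L}.Finite by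
      refine Set.Finite.of_finite_image (f := Subtype.val)
        ((hfin.image ψ).subset ?_) Subtype.val_injective.injOn
      rintro _ ⟨γ, ⟨q, ⟨p, hp, rfl⟩, hq⟩, rfl⟩
      obtain ⟨k, c, h⟩ := D.exists_normalForm γ.2
      refine ⟨(k, c), ⟨p, hp, ?_⟩, h.symm⟩
      change (translation (D.intVec c) * D.g₀ ^ k) p ∈ L
      rw [← h]
      exact hq
    -- the exponent is bounded
    have hlogc : Continuous fun p : ℍ × (Fin n → ℂ) ↦ Real.log p.1.im :=
      (UpperHalfPlane.continuous_im.comp continuous_fst).log fun p ↦ p.1.im_pos.ne'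
    obtain ⟨B, hB⟩ := (hK.union hL).exists_bound_of_continuousOn hlogc.continuousOn
    have hlog : Real.log D.α ≠ 0 := Real.log_ne_zero_of_pos_of_ne_one D.α_pos D.α_ne_one
    have hkfin : {k : ℤ | |(k : ℝ)| ≤ 2 * B / |Real.log D.α|}.Finite := by
      refine (Set.finite_Icc (-⌈2 * B / |Real.log D.α|⌉) ⌈2 * B / |Real.log D.α|⌉).subset ?_
      intro k hk
      have h1 := abs_le.1 (show |(k : ℝ)| ≤ _ from hk)
      have h2 := Int.le_ceil (2 * B / |Real.log D.α|)
      constructor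
      · exact_mod_cast (by push_cast; linarith : ((-⌈2 * B / |Real.log D.α|⌉ : ℤ) : ℝ) ≤ k)
      · exact_mod_cast (h1.2.trans h2)
    -- for a fixed exponent, the translation part is bounded
    have hcfin (k : ℤ) : {c : Fin (2 * n + 1) → ℤ | ∃ p ∈ K, ψ (k, c) p ∈ L}.Finite := by
      let F : (ℍ × (Fin n → ℂ)) → ℝ × (Fin n → ℂ) := fun p ↦ (p.1.re, p.2)
      have hF : Continuous F :=
        (UpperHalfPlane.continuous_re.comp continuous_fst).prodMk continuous_snd
      obtain ⟨B₁, hB₁⟩ := hL.exists_bound_of_continuousOn hF.continuousOn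
      obtain ⟨B₂, hB₂⟩ := hK.exists_bound_of_continuousOn
        (hF.comp (D.continuous_g₀_zpow k)).continuousOn
      obtain ⟨C, hC0, hC⟩ := D.latticeVec.exists_antilipschitzWith
        (LinearMap.ker_eq_bot.2 D.latticeVec_injective)
      refine (Set.finite_Icc (fun _ : Fin (2 * n + 1) ↦ -⌈(C : ℝ) * (B₁ + B₂)⌉)
        (fun _ ↦ ⌈(C : ℝ) * (B₁ + B₂)⌉)).subset ?_
      rintro c ⟨p, hp, hq⟩
      have hvec : D.intVec c = F (ψ (k, c) p) - F ((D.g₀ ^ k) p) := by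
        refine Prod.ext ?_ ?_
        · simp [F, ψ, translation]
        · simp [F, ψ, translation]
      have hnorm : ‖D.intVec c‖ ≤ B₁ + B₂ := by
        rw [hvec]
        exact (norm_sub_le _ _).trans (add_le_add (hB₁ _ hq) (hB₂ _ hp))
      have hc : ‖fun i ↦ (c i : ℝ)‖ ≤ C * (B₁ + B₂) := by
        have := hC.le_mul_dist (fun i ↦ (c i : ℝ)) 0
        rw [map_zero, dist_zero_right, dist_zero_right] at this
        exact this.trans (mul_le_mul_of_nonneg_left hnorm C.2)
      have hci (i : Fin (2 * n + 1)) : |(c i : ℝ)| ≤ C * (B₁ + B₂) :=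
        (norm_le_pi_norm (fun i ↦ (c i : ℝ)) i).trans hc
      have h2 := Int.le_ceil ((C : ℝ) * (B₁ + B₂))
      constructor
      · intro i
        have h1 := abs_le.1 (hci i)
        exact_mod_cast (by push_cast; linarith : ((-⌈(C : ℝ) * (B₁ + B₂)⌉ : ℤ) : ℝ) ≤ c i)
      · intro i
        have h1 := abs_le.1 (hci i)
        exact_mod_cast (h1.2.trans h2)
    refine ((hkfin.biUnion fun k _ ↦ (hcfin k).image fun c ↦ (k, c))).subset ?_
    rintro ⟨k, c⟩ ⟨p, hp, hq⟩
    refine Set.mem_biUnion (x := k) ?_ ⟨c, ⟨p, hp, hq⟩, rfl⟩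
    have him := D.im_normalForm k c p
    have hl : Real.log (ψ (k, c) p).1.im = k * Real.log D.α + Real.log p.1.im := by
      change Real.log ((translation (D.intVec c) * D.g₀ ^ k) p).1.im = _
      rw [him, Real.log_mul (zpow_pos D.α_pos k).ne' p.1.im_pos.ne', Real.log_zpow]
    have h1 := hB _ (Or.inr hq)
    have h2 := hB _ (Or.inl hp)
    rw [Real.norm_eq_abs] at h1 h2
    change |(k : ℝ)| ≤ 2 * B / |Real.log D.α|
    rw [le_div_iff₀ (abs_pos.2 hlog), ← abs_mul]
    have h3 : (k : ℝ) * Real.log D.α = Real.log (ψ (k, c) p).1.im - Real.log p.1.im := by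
      rw [hl]; ring
    rw [h3]
    exact (abs_sub _ _).trans (by linarith)

/-! #### The complex manifold `T_M` -/

/-- The inclusion `ℍ × ℂⁿ → ℂ × ℂⁿ`. -/
def incl (n : ℕ) (p : ℍ × (Fin n → ℂ)) : ℂ × (Fin n → ℂ) := (p.1, p.2)

lemma isOpenEmbedding_incl (n : ℕ) : Topology.IsOpenEmbedding (incl n) :=
  UpperHalfPlane.isOpenEmbedding_coe.prodMap Topology.IsOpenEmbedding.id

/-- `ℍ × ℂⁿ` as an open subset of `ℂ × ℂⁿ`, with a single global chart. -/
instance chartedSpace_cover (n : ℕ) : ChartedSpace (ℂ × (Fin n → ℂ)) (ℍ × (Fin n → ℂ)) :=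
  (isOpenEmbedding_incl n).singletonChartedSpace

/-- The Endo–Pajitnov manifold `T_M`, the quotient of `ℍ × ℂⁿ` by the group `G_M`. -/
abbrev T : Type := MulAction.orbitRel.Quotient D.G (ℍ × (Fin n → ℂ))

/-- The charts of `T_M` are the local inverses of the projection `ℍ × ℂⁿ → T_M`. -/
instance chartedSpace_T : ChartedSpace (ℂ × (Fin n → ℂ)) D.T :=
  MulAction.instChartedSpaceQuotient

lemma exists_contDiff {γ : Equiv.Perm (ℍ × (Fin n → ℂ))} (hγ : γ ∈ D.G) :
    ∃ A : ℂ × (Fin n → ℂ) → ℂ × (Fin n → ℂ), ContDiff ℂ ω A ∧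
      ∀ p, incl n (γ p) = A (incl n p) := by
  have htr (v : ℝ × (Fin n → ℂ)) : ∃ A : ℂ × (Fin n → ℂ) → ℂ × (Fin n → ℂ), ContDiff ℂ ω A ∧
      ∀ p, incl n (translation v p) = A (incl n p) := by
    refine ⟨fun q ↦ ((v.1 : ℂ) + q.1, q.2 + v.2), by fun_prop, fun p ↦ rfl⟩
  have hlin (r : {x : ℝ // 0 < x}) (A : Matrix (Fin n) (Fin n) ℂ) :
      ∃ B : ℂ × (Fin n → ℂ) → ℂ × (Fin n → ℂ), ContDiff ℂ ω B ∧
      ∀ p : ℍ × (Fin n → ℂ), incl n (r • p.1, A *ᵥ p.2) = B (incl n p) := by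
    refine ⟨fun q ↦ (((r : ℝ) : ℂ) * q.1, A.mulVecLin.toContinuousLinearMap q.2), by fun_prop,
      fun p ↦ ?_⟩
    refine Prod.ext ?_ rfl
    simp [incl]
  have hpow (k : ℤ) : ∃ A : ℂ × (Fin n → ℂ) → ℂ × (Fin n → ℂ), ContDiff ℂ ω A ∧
      ∀ p, incl n ((D.g₀ ^ k) p) = A (incl n p) := by
    induction k with
    | zero => exact ⟨id, contDiff_id, fun p ↦ rfl⟩
    | succ k ih =>
      obtain ⟨A, hA, hA'⟩ := ih
      obtain ⟨B, hB, hB'⟩ := hlin ⟨D.α, D.α_pos⟩ D.Rᵀ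
      refine ⟨A ∘ B, hA.comp hB, fun p ↦ ?_⟩
      rw [zpow_add_one, Equiv.Perm.mul_apply, hA', Function.comp, ← hB']
      rfl
    | pred k ih =>
      obtain ⟨A, hA, hA'⟩ := ih
      obtain ⟨B, hB, hB'⟩ := hlin ⟨D.α⁻¹, inv_pos.2 D.α_pos⟩ D.Rᵀ⁻¹
      refine ⟨A ∘ B, hA.comp hB, fun p ↦ ?_⟩
      rw [zpow_sub_one, Equiv.Perm.mul_apply, hA', Function.comp, ← hB']
      rfl
  obtain ⟨k, c, rfl⟩ := D.exists_normalForm hγ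
  obtain ⟨A, hA, hA'⟩ := hpow k
  obtain ⟨B, hB, hB'⟩ := htr (D.intVec c)
  refine ⟨B ∘ A, hB.comp hA, fun p ↦ ?_⟩
  rw [Equiv.Perm.mul_apply, hB', hA']
  rfl

lemma contDiffOn_transition
    (hloc : IsLocalHomeomorph (Quotient.mk (MulAction.orbitRel D.G (ℍ × (Fin n → ℂ)))))
    (p p' : ℍ × (Fin n → ℂ)) :
    ContDiffOn ℂ ω
      ((hloc.localInverseAt p ≫ₕ chartAt (ℂ × (Fin n → ℂ)) p).symm ≫ₕ
        hloc.localInverseAt p' ≫ₕ chartAt (ℂ × (Fin n → ℂ)) p')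
      ((hloc.localInverseAt p ≫ₕ chartAt (ℂ × (Fin n → ℂ)) p).symm ≫ₕ
        hloc.localInverseAt p' ≫ₕ chartAt (ℂ × (Fin n → ℂ)) p').source := by
  intro y hy
  refine ContDiffAt.contDiffWithinAt ?_
  have hcoe (x : ℍ × (Fin n → ℂ)) : ⇑(chartAt (ℂ × (Fin n → ℂ)) x) = incl n := rfl
  set φ := chartAt (ℂ × (Fin n → ℂ)) p with hφ
  simp only [OpenPartialHomeomorph.trans_source, OpenPartialHomeomorph.symm_source,
    OpenPartialHomeomorph.trans_target, Set.mem_inter_iff, Set.mem_preimage,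
    OpenPartialHomeomorph.coe_trans_symm, Function.comp_apply,
    IsLocalHomeomorph.localInverseAt_symm] at hy
  obtain ⟨⟨hy1, -⟩, hy3, -⟩ := hy
  have hx : (hloc.localInverseAt p') (Quotient.mk _ (φ.symm y)) ∈
      MulAction.orbit D.G (φ.symm y) :=
    Quotient.exact (hloc.apply_localInverseAt_of_mem hy3)
  obtain ⟨γ, hγ⟩ := hx
  obtain ⟨A, hA, hA'⟩ := D.exists_contDiff γ.2
  have hcont : ContinuousAt (fun z ↦ γ • φ.symm z) y :=
    (φ.symm.continuousAt hy1).const_smul γ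
  have hmem : (fun z ↦ γ • φ.symm z) y ∈ (hloc.localInverseAt p').target := by
    change γ • φ.symm y ∈ _
    rw [show γ • φ.symm y = _ from hγ]
    exact (hloc.localInverseAt p').map_source hy3
  have hev := hcont.eventually_mem ((hloc.localInverseAt p').open_target.mem_nhds hmem)
  refine hA.contDiffAt.congr_of_eventuallyEq ?_
  filter_upwards [hev, φ.open_target.mem_nhds hy1] with z hz hz1
  have h1 : (Quotient.mk _ (φ.symm z) : D.T) = Quotient.mk _ (γ • φ.symm z) :=
    Quotient.sound (MulAction.orbitRel_apply.2 ⟨γ⁻¹, by simp⟩)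
  have h2 : (hloc.localInverseAt p') (Quotient.mk _ (φ.symm z)) = γ • φ.symm z := by
    rw [h1]
    have := (hloc.localInverseAt p').right_inv hz
    rwa [hloc.localInverseAt_symm] at this
  have h3 : incl n (φ.symm z) = z := φ.right_inv hz1
  simp only [OpenPartialHomeomorph.coe_trans, OpenPartialHomeomorph.coe_trans_symm,
    Function.comp_apply, IsLocalHomeomorph.localInverseAt_symm, hcoe]
  rw [h2]
  conv_rhs => rw [← h3]
  exact hA' _

/-- `T_M` is a complex manifold. -/
instance isManifold_T : IsManifold 𝓘(ℂ, ℂ × (Fin n → ℂ)) ω D.T := by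
  refine isManifold_of_contDiffOn _ ω D.T fun e e' he he' ↦ ?_
  obtain ⟨q, rfl⟩ := he
  obtain ⟨q', rfl⟩ := he'
  simpa only [modelWithCornersSelf_coe, modelWithCornersSelf_coe_symm, Function.id_comp,
    Function.comp_id, Set.preimage_id, Set.range_id, Set.inter_univ] using
    D.contDiffOn_transition _ _ _

end EndoPajitnovData

end

/-! Suppose such a metric exists and let W be the pullback of its fundamental form to ℍ × ℂⁿ. In
complex dimension at least two, W determines the differential of a local conformal factor
(`IsLeeFormAt.unique`). On the convex domain ℍ × ℂⁿ these differentials glue to an exact form dF,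
and e^{-F} W is closed everywhere. Deck transformations preserve W, so they change F by constants: a
character χ of the translation lattice, and a number s for g₀. Conjugation by g₀ acts on the lattice
through Mᵀ, and 1 is not an eigenvalue of M, so χ = 0. Thus e^{-F} W is invariant under the lattice
and is multiplied by κ = e^{-s} under g₀.

Averaging this form over the torus of lattice translations gives a closed positive form B that is
invariant under all translations by ℝ × ℂⁿ, so its coefficients depend on Im w only. Closedness then
makes the restriction of B to the ℂⁿ directions constant. If Rᵀ z = β z, homothety gives |β|² B(z,
iz) = κ B(z, iz), and positivity gives |β|² = κ. This holds for every eigenvalue β in the upper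
half-plane (`IsHomotheticKahlerForm.normSq_eigenvalue_eq`). One eigenvector per eigenvalue suffices,
so M need not be diagonalizable.

Equal moduli are arithmetically impossible (`eq_one_of_roots_normSq_eq`). The determinant gives α²
κ^{2n} = 1, so κ = 1 would force α = 1. If κ ≠ 1, the characteristic polynomial is irreducible. As
2n + 1 ≥ 5, there are two distinct conjugate pairs {x, x̄} and {y, ȳ} of roots, with x x̄ = y ȳ. A
Galois automorphism with x ↦ α turns this equality into α² κ = κ². Hence α² = κ and κ^{2n+1} = 1,
again forcing α = 1. -/

noncomputable section

/-! ### Integral polynomials whose roots have equal moduli -/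

section Units

open Polynomial

lemma prod_normSq_roots_eq_one {s : ℤ[X]} (hs : s.Monic) (h0 : IsUnit (s.coeff 0)) :
    ((s.map (Int.castRingHom ℂ)).roots.map Complex.normSq).prod = 1 := by
  have h1 := (IsAlgClosed.splits (s.map (Int.castRingHom ℂ))).coeff_zero_eq_prod_roots_of_monic
    (hs.map _)
  have h2 := congrArg Complex.normSq h1
  rw [map_mul, map_pow, Complex.normSq_neg, map_one, one_pow, one_mul, coeff_map,
    map_multiset_prod] at h2
  rw [← h2]
  rcases Int.isUnit_iff.1 h0 with h | h <;> simp [h]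

/-- The squared moduli of the roots multiply to 1, and their product is also κ to the power of the
degree. -/
lemma natDegree_eq_zero_of_roots_normSq_eq {s : ℤ[X]} (hs : s.Monic) (h0 : IsUnit (s.coeff 0))
    {κ : ℝ} (hκ : κ ≠ 1)
    (hroot : ∀ z, (s.map (Int.castRingHom ℂ)).IsRoot z → Complex.normSq z = κ) :
    s.natDegree = 0 := by
  by_contra hdeg
  have hne : s.map (Int.castRingHom ℂ) ≠ 0 := (hs.map _).ne_zero
  have h1 := prod_normSq_roots_eq_one hs h0
  rw [Multiset.map_congr rfl fun z hz ↦ hroot z ((mem_roots hne).1 hz), Multiset.map_const',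
    Multiset.prod_replicate, ← (IsAlgClosed.splits _).natDegree_eq_card_roots,
    hs.natDegree_map] at h1
  -- A root is needed only to know that κ ≥ 0, which excludes κ = -1.
  obtain ⟨z, hz⟩ := IsAlgClosed.exists_root (s.map (Int.castRingHom ℂ)) (by
    rw [degree_eq_natDegree hne, hs.natDegree_map]
    exact_mod_cast hdeg)
  have hnn : 0 ≤ κ := hroot z hz ▸ Complex.normSq_nonneg z
  exact hκ ((pow_eq_one_iff_of_nonneg hnn hdeg).1 h1)

/-- If all roots but one of an integral polynomial have the same squared modulus, and the product
of all the roots is a unit, then the polynomial is irreducible. -/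
lemma eq_minpoly_of_roots_normSq_eq {p : ℤ[X]} (hp : p.Monic) (h0 : IsUnit (p.coeff 0)) {α : ℂ}
    (hα : (p.map (Int.castRingHom ℂ)).rootMultiplicity α = 1) {κ : ℝ} (hκ : κ ≠ 1)
    (hroot : ∀ z, (p.map (Int.castRingHom ℂ)).IsRoot z → z ≠ α → Complex.normSq z = κ) :
    minpoly ℤ α = p := by
  have hne : p.map (Int.castRingHom ℂ) ≠ 0 := (hp.map _).ne_zero
  have hαroot : (p.map (Int.castRingHom ℂ)).IsRoot α :=
    (rootMultiplicity_pos hne).1 (by omega)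
  have haeval : aeval α p = 0 := by
    rw [aeval_def, ← eval_map]; exact hαroot
  have hint : IsIntegral ℤ α := ⟨p, hp, haeval⟩
  -- The cofactor `s` has a unit as constant coefficient, and α is not a root of it because α is a
  -- simple root of `p`. So all its roots have squared modulus κ ≠ 1, and `s` is constant.
  obtain ⟨s, hs⟩ := minpoly.isIntegrallyClosed_dvd hint haeval
  have hqm := minpoly.monic hint
  have hsm : s.Monic := hqm.of_mul_monic_left (hs ▸ hp)
  have hs0 : IsUnit (s.coeff 0) := by
    rw [hs, mul_coeff_zero] at h0
    exact isUnit_of_mul_isUnit_right h0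
  have hmap : p.map (Int.castRingHom ℂ) =
      (minpoly ℤ α).map (Int.castRingHom ℂ) * s.map (Int.castRingHom ℂ) := by
    conv_lhs => rw [hs]
    rw [Polynomial.map_mul]
  have hsroot : ∀ z, (s.map (Int.castRingHom ℂ)).IsRoot z → Complex.normSq z = κ := by
    intro z hz
    refine hroot z ?_ ?_
    · rw [hmap]; exact root_mul_left_of_isRoot _ hz
    · rintro rfl
      have h1 : ((minpoly ℤ z).map (Int.castRingHom ℂ)).IsRoot z := by
        have := minpoly.aeval ℤ z
        rwa [aeval_def, ← eval_map] at this
      have h2 := hne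
      rw [hmap] at hα h2
      rw [rootMultiplicity_mul h2] at hα
      have h3 := (rootMultiplicity_pos (left_ne_zero_of_mul h2)).2 h1
      have h4 := (rootMultiplicity_pos (right_ne_zero_of_mul h2)).2 hz
      omega
  have hdeg := natDegree_eq_zero_of_roots_normSq_eq hsm hs0 hκ hsroot
  have hs1 : s = 1 := hsm.natDegree_eq_zero.1 hdeg
  rw [hs, hs1, mul_one]

/-- A positive real unit of degree at least five, all of whose other conjugates are non-real and
of the same modulus, is equal to one. -/
theorem eq_one_of_roots_normSq_eq {p : ℤ[X]} (hp : p.Monic) (h0 : IsUnit (p.coeff 0))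
    (hdeg : 5 ≤ p.natDegree) {α : ℝ} (hpos : 0 < α)
    (hα : (p.map (Int.castRingHom ℂ)).rootMultiplicity (α : ℂ) = 1) {κ : ℝ}
    (hroot : ∀ z, (p.map (Int.castRingHom ℂ)).IsRoot z → z ≠ α →
      z.im ≠ 0 ∧ Complex.normSq z = κ) :
    α = 1 := by
  set P := p.map (Int.castRingHom ℂ) with hP
  have hne : P ≠ 0 := (hp.map _).ne_zero
  have hαroot : P.IsRoot α := (rootMultiplicity_pos hne).1 (by omega)
  have hcard : P.roots.card = p.natDegree := by
    rw [← (IsAlgClosed.splits P).natDegree_eq_card_roots, hP, hp.natDegree_map]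
  have hcount : P.roots.count (α : ℂ) = 1 := by rw [count_roots, hα]
  obtain ⟨t, ht⟩ := Multiset.exists_cons_of_mem ((mem_roots hne).2 hαroot)
  have hαt : (α : ℂ) ∉ t := by
    rw [ht, Multiset.count_cons_self] at hcount
    exact Multiset.count_eq_zero.1 (by omega)
  have hprod : α ^ 2 * κ ^ (p.natDegree - 1) = 1 := by
    have h1 := prod_normSq_roots_eq_one hp h0
    rw [← hP, ht, Multiset.map_cons, Multiset.prod_cons, Multiset.map_congr rfl fun z hz ↦
      (hroot z ((mem_roots hne).1 (ht ▸ Multiset.mem_cons_of_mem hz))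
        (fun h ↦ hαt (h ▸ hz))).2, Multiset.map_const', Multiset.prod_replicate] at h1
    have h2 : t.card = p.natDegree - 1 := by
      rw [← hcard, ht, Multiset.card_cons, Nat.add_sub_cancel]
    rw [← h2, ← h1, Complex.normSq_ofReal, sq]
  -- If α² = κ, then `hprod` says that κ to the power of the degree is 1, so κ = 1. If κ = 1, it
  -- says α² = 1.
  suffices hκα : α ^ 2 = κ ∨ κ = 1 by
    have h2 : α ^ 2 = 1 := by
      rcases hκα with h | h
      · rw [h, ← pow_succ'] at hprod
        rw [h]
        exact (pow_eq_one_iff_of_nonneg (h ▸ sq_nonneg α) (by omega)).1 hprod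
      · simpa [h] using hprod
    exact (pow_eq_one_iff_of_nonneg hpos.le two_ne_zero).1 h2
  by_cases hκ : κ = 1
  · exact Or.inr hκ
  left
  have hmin := eq_minpoly_of_roots_normSq_eq hp h0 hα hκ fun z hz hz' ↦ (hroot z hz hz').2
  have haeval (z : ℂ) (hz : P.IsRoot z) : aeval z p = 0 := by
    rw [aeval_def, ← eval_map]; exact hz
  have hint : IsIntegral ℤ (α : ℂ) := ⟨p, hp, haeval _ hαroot⟩
  have hmin' : minpoly ℚ (α : ℂ) = p.map (algebraMap ℤ ℚ) := by
    rw [minpoly.isIntegrallyClosed_eq_field_fractions' ℚ hint, hmin]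
  have hirr : Irreducible (p.map (algebraMap ℤ ℚ)) := by
    rw [← hmin']; exact minpoly.irreducible (hint.tower_top)
  have hminroot (z : ℂ) (hz : P.IsRoot z) : minpoly ℚ z = p.map (algebraMap ℤ ℚ) := by
    refine (minpoly.eq_of_irreducible_of_monic hirr ?_ (hp.map _)).symm
    rw [aeval_map_algebraMap]; exact haeval z hz
  have hPmap : (p.map (algebraMap ℤ ℚ)).map (algebraMap ℚ ℂ) = P := by
    rw [Polynomial.map_map, hP]
    congr 1
  have hnodup : P.roots.Nodup := by
    rw [← hPmap]
    exact nodup_roots hirr.separable.map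
  have hconj (z : ℂ) (hz : P.IsRoot z) : P.IsRoot (star z) := by
    have h1 := congrArg (starRingEnd ℂ) hz
    rw [eval_map, hom_eval₂, map_zero] at h1
    rw [IsRoot, eval_map, ← h1]
    congr 1
    exact RingHom.ext_int _ _
  -- Irreducibility makes the roots distinct, so at least five are available: α and two conjugate
  -- pairs.
  have hout (S : Finset ℂ) (hS : S.card < 5) : ∃ z, P.IsRoot z ∧ z ∉ S := by
    by_contra! h
    have h1 : P.roots.toFinset ⊆ S := fun z hz ↦
      h z ((mem_roots hne).1 (Multiset.mem_toFinset.1 hz))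
    have h2 := Finset.card_le_card h1
    rw [Multiset.toFinset_card_of_nodup hnodup, hcard] at h2
    omega
  obtain ⟨x, hx, hxα⟩ := hout {(α : ℂ)} (by simp)
  obtain ⟨y, hy, hyS⟩ := hout {(α : ℂ), x, star x} (Finset.card_le_three.trans_lt (by norm_num))
  simp only [Finset.mem_insert, Finset.mem_singleton, not_or] at hxα hyS
  let K := algebraicClosure ℚ ℂ
  have hmem (z : ℂ) (hz : P.IsRoot z) : z ∈ K := by
    rw [mem_algebraicClosure_iff]
    exact ⟨p.map (algebraMap ℤ ℚ), hirr.ne_zero, by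
      rw [aeval_map_algebraMap]; exact haeval z hz⟩
  have : IsAlgClosure ℚ K := algebraicClosure.isAlgClosure ℚ ℂ
  have : Normal ℚ K := IsAlgClosure.normal ℚ K
  let lift (z : ℂ) (hz : P.IsRoot z) : K := ⟨z, hmem z hz⟩
  have hminK (z : ℂ) (hz : P.IsRoot z) : minpoly ℚ (lift z hz) = p.map (algebraMap ℤ ℚ) := by
    rw [← hminroot z hz]
    exact (minpoly.algebraMap_eq (B' := ℂ) (algebraMap K ℂ).injective (lift z hz)).symm
  -- All roots of the irreducible polynomial are conjugate over ℚ, so some `σ` carries x to α. Every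
  -- other root then goes to a root different from α, of squared modulus κ.
  obtain ⟨σ, hσ⟩ := isConjRoot_iff_exists_algEquiv.1
    ((isConjRoot_def (R := ℚ)).2 ((hminK α hαroot).trans (hminK x hx).symm))
  have hσroot (z : K) (hz : P.IsRoot (z : ℂ)) : P.IsRoot (σ z : ℂ) := by
    have h1 : aeval (σ z) (p.map (algebraMap ℤ ℚ)) = 0 := by
      rw [← hminK z hz, show lift z hz = z from rfl, aeval_algHom_apply, minpoly.aeval, map_zero]
    have h2 := congrArg (algebraMap K ℂ) h1
    rw [← aeval_algebraMap_apply, map_zero, aeval_def, ← eval_map, hPmap] at h2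
    exact h2
  have hσnorm (z : ℂ) (hz : P.IsRoot z) (hzx : z ≠ x) :
      Complex.normSq (σ (lift z hz) : ℂ) = κ := by
    refine (hroot _ (hσroot _ hz) fun h ↦ hzx ?_).2
    have h1 : σ (lift z hz) = σ (lift x hx) := by
      rw [hσ]; exact Subtype.ext h
    exact congrArg Subtype.val (σ.injective h1)
  have hnx : star x ≠ x := fun h ↦
    (hroot x hx hxα).1 (Complex.conj_eq_iff_im.1 h)
  have hny : star y ≠ x := fun h ↦ hyS.2.2 (by rw [← h, star_star])
  have hmul : lift x hx * lift (star x) (hconj x hx) = lift y hy * lift (star y) (hconj y hy) := by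
    refine Subtype.ext ?_
    change x * star x = y * star y
    rw [Complex.star_def, Complex.mul_conj, Complex.mul_conj,
      (hroot x hx hxα).2, (hroot y hy hyS.1).2]
  -- Applying `σ` to x x̄ = y ȳ, only the factor x is sent to α; taking squared moduli gives α² κ =
  -- κ².
  have h1 := congrArg (fun k : K ↦ Complex.normSq (k : ℂ)) (congrArg σ hmul)
  simp only [map_mul, MulMemClass.coe_mul] at h1
  rw [hσnorm _ (hconj x hx) hnx, hσnorm _ (hconj y hy) hny, hσnorm _ hy hyS.2.1, hσ] at h1
  change Complex.normSq (α : ℂ) * κ = κ * κ at h1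
  have hκ0 : κ ≠ 0 := by
    rintro rfl
    rw [zero_pow (by omega), mul_zero] at hprod
    exact zero_ne_one hprod
  rw [Complex.normSq_ofReal, ← sq] at h1
  exact mul_right_cancel₀ hκ0 h1

end Units

/-! ### The eigenvalues of `M` -/

namespace EndoPajitnovData

variable {n : ℕ} (D : EndoPajitnovData n)

/-- The eigenvalues of `R` do not all have the same modulus if `n > 1`. -/
theorem not_forall_normSq_eigenvalue_eq (hn : 1 < n) (κ : ℝ)
    (h : ∀ β : ℂ, 0 < β.im → (complexMul D.M).HasEigenvalue β → Complex.normSq β = κ) : False := by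
  have hchar : LinearMap.charpoly (complexMul D.M) =
      D.M.1.charpoly.map (Int.castRingHom ℂ) := by
    rw [complexMul, Matrix.charpoly_toLin']
    exact Matrix.charpoly_map D.M.1 (Int.castRingHom ℂ)
  have heig (z : ℂ) : (complexMul D.M).HasEigenvalue z ↔
      (D.M.1.charpoly.map (Int.castRingHom ℂ)).IsRoot z := by
    rw [← hchar]; exact Module.End.hasEigenvalue_iff_isRoot_charpoly _ _
  refine D.α_ne_one (eq_one_of_roots_normSq_eq (p := D.M.1.charpoly) (κ := κ)
    (Matrix.charpoly_monic _) ?_ ?_ D.α_pos (by rw [← hchar]; exact D.α_simple) ?_)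
  · have h1 := Matrix.det_eq_sign_charpoly_coeff D.M.1
    rw [D.M.2] at h1
    exact IsUnit.of_mul_eq_one _ (by rw [mul_comm]; exact h1.symm)
  · rw [Matrix.charpoly_natDegree_eq_dim, Fintype.card_fin]; omega
  · intro z hz hzα
    have him := D.im_ne_zero z ((heig z).2 hz) hzα
    refine ⟨him, ?_⟩
    -- The characteristic polynomial is real, so eigenvalues in the lower half-plane are conjugates
    -- of those covered by `h`.
    rcases him.lt_or_gt with h1 | h1
    · rw [← Complex.normSq_conj]
      refine h _ (by simpa using h1) ((heig _).2 ?_)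
      have h2 := congrArg (starRingEnd ℂ) hz
      rw [Polynomial.eval_map, Polynomial.hom_eval₂, map_zero] at h2
      rw [Polynomial.IsRoot, Polynomial.eval_map, ← h2]
      congr 1
      exact RingHom.ext_int _ _
    · exact h z h1 ((heig z).2 hz)

end EndoPajitnovData

/-! ### Conformally closed two-forms and their Lee forms -/

section TwoForms

set_option maxSynthPendingDepth 3

variable {E : Type*} [NormedAddCommGroup E] [NormedSpace ℝ E]

/-- The equation `dW = θ ∧ W` at the point `p`, for a two-form `W` and a covector `θ`. -/
def IsLeeFormAt (W : E → E →L[ℝ] E →L[ℝ] ℝ) (p : E) (θ : E →L[ℝ] ℝ) : Prop :=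
  ∀ a b c, fderiv ℝ W p a b c + fderiv ℝ W p b c a + fderiv ℝ W p c a b =
    θ a * W p b c + θ b * W p c a + θ c * W p a b

lemma fderiv_exp_neg_smul_apply {W : E → E →L[ℝ] E →L[ℝ] ℝ} {f : E → ℝ} {p : E}
    (hW : DifferentiableAt ℝ W p) (hf : DifferentiableAt ℝ f p) (a b c : E) :
    fderiv ℝ (fun q ↦ Real.exp (-f q) • W q) p a b c =
      Real.exp (-f p) * (fderiv ℝ W p a b c - fderiv ℝ f p a * W p b c) := by
  have h := HasFDerivAt.fun_smul hf.hasFDerivAt.fun_neg.exp hW.hasFDerivAt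
  rw [h.fderiv]
  simp
  ring

/-- This is d(e^{-f} W) = e^{-f} (dW - df ∧ W); the Lee form 0 expresses closedness. -/
lemma isLeeFormAt_exp_neg_smul_zero_iff {W : E → E →L[ℝ] E →L[ℝ] ℝ} {f : E → ℝ} {p : E}
    (hW : DifferentiableAt ℝ W p) (hf : DifferentiableAt ℝ f p) :
    IsLeeFormAt (fun q ↦ Real.exp (-f q) • W q) p 0 ↔ IsLeeFormAt W p (fderiv ℝ f p) := by
  refine forall_congr' fun a ↦ forall_congr' fun b ↦ forall_congr' fun c ↦ ?_
  simp only [fderiv_exp_neg_smul_apply hW hf, zero_apply, zero_mul, add_zero]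
  rw [← mul_add, ← mul_add, mul_eq_zero, or_iff_right (Real.exp_pos _).ne',
    ← sub_eq_zero (b := _ + _)]
  ring_nf

/-- The differential of an affine map is constant, so the chain rule for W produces no second-order
terms and the Lee equation pulls back directly. -/
lemma IsLeeFormAt.comp_affine {W : E → E →L[ℝ] E →L[ℝ] ℝ} {p : E} {θ : E →L[ℝ] ℝ}
    (A : E →L[ℝ] E) (v : E) (hW : DifferentiableAt ℝ W (A p + v))
    (hinv : ∀ᶠ q in 𝓝 p, ∀ x y, W (A q + v) (A x) (A y) = W q x y)
    (h : IsLeeFormAt W (A p + v) θ) : IsLeeFormAt W p (θ ∘L A) := by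
  have hpull (a b c : E) : fderiv ℝ W p a b c = fderiv ℝ W (A p + v) (A a) (A b) (A c) := by
    have h1 : HasFDerivAt (fun q ↦ W (A q + v)) (fderiv ℝ W (A p + v) ∘L A) p :=
      HasFDerivAt.comp p hW.hasFDerivAt (A.hasFDerivAt.add_const v)
    let T : (E →L[ℝ] E →L[ℝ] ℝ) →L[ℝ] (E →L[ℝ] E →L[ℝ] ℝ) :=
      (ContinuousLinearMap.compL ℝ E (E →L[ℝ] ℝ) (E →L[ℝ] ℝ)
        (ContinuousLinearMap.precomp ℝ A)) ∘L (ContinuousLinearMap.precomp _ A)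
    have h2 : HasFDerivAt (fun q ↦ T (W (A q + v))) (T ∘L (fderiv ℝ W (A p + v) ∘L A)) p :=
      T.hasFDerivAt.comp p h1
    have h3 : W =ᶠ[𝓝 p] fun q ↦ T (W (A q + v)) := by
      filter_upwards [hinv] with q hq
      ext x y
      exact (hq x y).symm
    rw [h3.fderiv_eq, h2.fderiv]
    rfl
  intro a b c
  have h0 := hinv.self_of_nhds
  rw [hpull, hpull, hpull, h, h0, h0, h0]
  rfl

/-- Given a, more than two real dimensions leave room for b ≠ 0 with W(a, b) = W(a, Jb) = 0. On (a,
b, Jb) the form θ ∧ W then reduces to θ(a) W(b, Jb), and W(b, Jb) > 0. -/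
lemma IsLeeFormAt.unique [FiniteDimensional ℝ E] (hdim : 2 < Module.finrank ℝ E) {J : E →ₗ[ℝ] E}
    {W : E → E →L[ℝ] E →L[ℝ] ℝ} {p : E} (halt : ∀ u, W p u u = 0)
    (hpos : ∀ u, u ≠ 0 → 0 < W p u (J u)) {θ θ' : E →L[ℝ] ℝ}
    (h : IsLeeFormAt W p θ) (h' : IsLeeFormAt W p θ') : θ = θ' := by
  have hanti (u v : E) : W p u v = -W p v u := by
    have := halt (u + v)
    simp only [map_add, add_apply, halt] at this
    linarith
  ext a
  let φ : E →ₗ[ℝ] ℝ × ℝ := (W p a : E →ₗ[ℝ] ℝ).prod ((W p a : E →ₗ[ℝ] ℝ) ∘ₗ J)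
  have hker : LinearMap.ker φ ≠ ⊥ := φ.ker_ne_bot_of_finrank_lt (by simpa using hdim)
  obtain ⟨b, hb, hb0⟩ := Submodule.exists_mem_ne_zero_of_ne_bot hker
  have hb1 : W p a b = 0 := congrArg Prod.fst hb
  have hb2 : W p a (J b) = 0 := congrArg Prod.snd hb
  have e1 := h a b (J b)
  have e2 := h' a b (J b)
  rw [hb1, hanti (J b) a, hb2] at e1 e2
  have h3 := hpos b hb0
  refine mul_right_cancel₀ h3.ne' ?_
  linarith

/-- A two-form that is locally conformally closed on a convex set is globally conformally
closed. -/
lemma exists_isLeeFormAt_fderiv [FiniteDimensional ℝ E] (hdim : 2 < Module.finrank ℝ E)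
    {J : E →ₗ[ℝ] E} {W : E → E →L[ℝ] E →L[ℝ] ℝ} {H : Set E} (hH : IsOpen H) (hHc : Convex ℝ H)
    (halt : ∀ p ∈ H, ∀ u, W p u u = 0) (hpos : ∀ p ∈ H, ∀ u, u ≠ 0 → 0 < W p u (J u))
    (hloc : ∀ p ∈ H, ∃ f : E → ℝ, ContDiffAt ℝ ∞ f p ∧
      ∀ᶠ q in 𝓝 p, IsLeeFormAt W q (fderiv ℝ f q)) :
    ∃ F : E → ℝ, ContDiffOn ℝ 1 F H ∧ ∀ p ∈ H, IsLeeFormAt W p (fderiv ℝ F p) := by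
  choose! f hf hfW using hloc
  let θ : E → E →L[ℝ] ℝ := fun p ↦ fderiv ℝ (f p) p
  -- By uniqueness, `θ` agrees near each point with the differential of one smooth function. So it
  -- is C¹ with symmetric derivative, as the Poincaré lemma on the convex set requires.
  have hθ (p : E) (hp : p ∈ H) : θ =ᶠ[𝓝 p] fderiv ℝ (f p) := by
    filter_upwards [hfW p hp, hH.mem_nhds hp] with q hq hqH
    exact IsLeeFormAt.unique hdim (halt q hqH) (hpos q hqH) (hfW q hqH).self_of_nhds hq
  have hθd (p : E) (hp : p ∈ H) : ContDiffAt ℝ 1 θ p :=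
    (((hf p hp).fderiv_right (m := 1) (by norm_cast))).congr_of_eventuallyEq
      (hθ p hp)
  obtain ⟨F, hF⟩ := hHc.exists_forall_hasFDerivAt_of_fderiv_symmetric hH 
    (fun p (hp : p ∈ H) ↦ ((hθd p hp).differentiableAt one_ne_zero).differentiableWithinAt) (by
      intro p hp x y
      rw [(hθ p hp).fderiv_eq]
      exact ((hf p hp).isSymmSndFDerivAt
        (by simpa using WithTop.coe_le_coe.2 (le_top : (2 : ℕ∞) ≤ ⊤))) x y)
  refine ⟨F, ?_, fun p hp ↦ (hF p hp).fderiv ▸ (hfW p hp).self_of_nhds⟩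
  rw [show (1 : WithTop ℕ∞) = 0 + 1 by simp, contDiffOn_succ_iff_fderiv_of_isOpen hH, contDiffOn_zero]
  refine ⟨fun p hp ↦ (hF p hp).differentiableAt.differentiableWithinAt, by simp, ?_⟩
  refine ContinuousOn.congr (f := θ) (fun p hp ↦ (hθd p hp).continuousAt.continuousWithinAt)
    fun p hp ↦ (hF p hp).fderiv

/-- A primitive of the Lee form changes by a constant under affine automorphisms of the
two-form. -/
lemma exists_forall_apply_affine_eq_add [FiniteDimensional ℝ E] (hdim : 2 < Module.finrank ℝ E)
    {J : E →ₗ[ℝ] E} {W : E → E →L[ℝ] E →L[ℝ] ℝ} {H : Set E} (hH : IsOpen H) (hHc : Convex ℝ H)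
    (halt : ∀ p ∈ H, ∀ u, W p u u = 0) (hpos : ∀ p ∈ H, ∀ u, u ≠ 0 → 0 < W p u (J u))
    (hW : DifferentiableOn ℝ W H) {F : E → ℝ} (hF : DifferentiableOn ℝ F H)
    (hFW : ∀ p ∈ H, IsLeeFormAt W p (fderiv ℝ F p)) (A : E →L[ℝ] E) (v : E)
    (hA : ∀ p ∈ H, A p + v ∈ H) (hinv : ∀ p ∈ H, ∀ x y, W (A p + v) (A x) (A y) = W p x y) :
    ∃ χ : ℝ, ∀ p ∈ H, F (A p + v) = F p + χ := by
  have hd (p : E) (hp : p ∈ H) : HasFDerivAt (fun q ↦ F (A q + v) - F q) (0 : E →L[ℝ] ℝ) p := by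
    have hF1 := (hF.differentiableAt (hH.mem_nhds (hA p hp))).hasFDerivAt
    have h1 : HasFDerivAt (fun q ↦ F (A q + v)) (fderiv ℝ F (A p + v) ∘L A) p :=
      hF1.comp p (A.hasFDerivAt.add_const v)
    -- Both sides are Lee forms of `W` at `p`, the left one because the affine map preserves `W`.
    have h2 : fderiv ℝ F (A p + v) ∘L A = fderiv ℝ F p := by
      refine IsLeeFormAt.unique hdim (halt p hp) (hpos p hp) (IsLeeFormAt.comp_affine A v
        (hW.differentiableAt (hH.mem_nhds (hA p hp))) ?_ (hFW _ (hA p hp))) (hFW p hp)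
      filter_upwards [hH.mem_nhds hp] with q hq using hinv q hq
    have h3 := h1.fun_sub (hF.differentiableAt (hH.mem_nhds hp)).hasFDerivAt
    rwa [h2, sub_self] at h3
  obtain rfl | ⟨p₀, hp₀⟩ := H.eq_empty_or_nonempty
  · exact ⟨0, by simp⟩
  refine ⟨F (A p₀ + v) - F p₀, fun p hp ↦ ?_⟩
  have := hHc.is_const_of_fderivWithin_eq_zero (𝕜 := ℝ) (f := fun q ↦ F (A q + v) - F q)
    (fun q hq ↦ (hd q hq).differentiableAt.differentiableWithinAt)
    (fun q hq ↦ by rw [fderivWithin_of_isOpen hH hq, (hd q hq).fderiv]) hp hp₀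
  linarith

end TwoForms

/-! ### Averages of periodic functions -/

section PeriodicAverages

set_option maxSynthPendingDepth 3

open MeasureTheory

variable {ι : Type*} [Fintype ι]

variable (ι) in
/-- The half-open unit cube, a fundamental domain of the lattice of integral vectors. -/
def unitCell : Set (ι → ℝ) := ZSpan.fundamentalDomain (Pi.basisFun ℝ ι)

lemma measurableSet_unitCell : MeasurableSet (unitCell ι) :=
  ZSpan.fundamentalDomain_measurableSet _

lemma isCompact_closure_unitCell : IsCompact (closure (unitCell ι)) :=
  (ZSpan.fundamentalDomain_isBounded _).isCompact_closure

lemma volume_unitCell : volume (unitCell ι) = 1 := by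
  classical
  rw [unitCell, ZSpan.volume_fundamentalDomain,
    show Matrix.of ⇑(Pi.basisFun ℝ ι) = (1 : Matrix ι ι ℝ) from ?_]
  · simp
  · ext i j
    simp [Matrix.one_apply, Pi.single_apply, eq_comm]

lemma mem_span_basisFun_iff (v : ι → ℝ) :
    v ∈ Submodule.span ℤ (Set.range (Pi.basisFun ℝ ι)) ↔ ∃ c : ι → ℤ, v = fun i ↦ (c i : ℝ) := by
  rw [Module.Basis.mem_span_iff_repr_mem]
  constructor
  · intro h
    choose c hc using h
    exact ⟨c, funext fun i ↦ by simpa using (hc i).symm⟩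
  · rintro ⟨c, rfl⟩ i
    exact ⟨c i, by simp⟩

lemma intCast_mulVec (A : Matrix ι ι ℤ) (c : ι → ℤ) :
    (A.map (Int.cast : ℤ → ℝ)) *ᵥ (fun i ↦ (c i : ℝ)) = fun i ↦ ((A *ᵥ c) i : ℝ) := by
  ext i
  simp [Matrix.mulVec, dotProduct]

variable [DecidableEq ι]

lemma measurePreserving_intCast_mulVec_add (A : Matrix.SpecialLinearGroup ι ℤ) (d : ι → ℝ) :
    MeasurePreserving (fun t : ι → ℝ ↦ (A.1.map (Int.cast : ℤ → ℝ)) *ᵥ t + d) := by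
  refine (measurePreserving_add_right volume d).comp
    (g := fun t ↦ t + d) (f := fun t ↦ (A.1.map (Int.cast : ℤ → ℝ)) *ᵥ t) ⟨?_, ?_⟩
  · exact (Continuous.matrix_mulVec continuous_const continuous_id).measurable
  · have hdet : (A.1.map (Int.cast : ℤ → ℝ)).det = 1 := by
      have := (Int.castRingHom ℝ).map_det A.1
      rw [A.2] at this
      simpa using this.symm
    have := Real.map_matrix_volume_pi_eq_smul_volume_pi (M := A.1.map (Int.cast : ℤ → ℝ))
      (by rw [hdet]; exact one_ne_zero)
    rw [hdet] at this
    rw [inv_one, abs_one, ENNReal.ofReal_one, one_smul] at this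
    exact this

lemma intCast_inv_mulVec_mulVec (A : Matrix.SpecialLinearGroup ι ℤ) (t : ι → ℝ) :
    (A⁻¹.1.map (Int.cast : ℤ → ℝ)) *ᵥ ((A.1.map (Int.cast : ℤ → ℝ)) *ᵥ t) = t := by
  have h : (A⁻¹.1.map (Int.cast : ℤ → ℝ)) * (A.1.map (Int.cast : ℤ → ℝ)) = 1 := by
    have := congrArg (fun B : Matrix.SpecialLinearGroup ι ℤ ↦ B.1.map (Int.castRingHom ℝ))
      (inv_mul_cancel A)
    rw [Matrix.SpecialLinearGroup.coe_mul, Matrix.map_mul, Matrix.SpecialLinearGroup.coe_one,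
      Matrix.map_one _ (map_zero _) (map_one _)] at this
    exact this
  rw [Matrix.mulVec_mulVec, h, Matrix.one_mulVec]

lemma intCast_mulVec_inv_mulVec (A : Matrix.SpecialLinearGroup ι ℤ) (t : ι → ℝ) :
    (A.1.map (Int.cast : ℤ → ℝ)) *ᵥ ((A⁻¹.1.map (Int.cast : ℤ → ℝ)) *ᵥ t) = t := by
  have := intCast_inv_mulVec_mulVec A⁻¹ t
  rwa [inv_inv] at this

/-- The average of a periodic function is invariant under affine automorphisms of the torus. -/
lemma setIntegral_unitCell_comp_affine {G : Type*} [NormedAddCommGroup G] [NormedSpace ℝ G]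
    {ψ : (ι → ℝ) → G} (hψ : ∀ (c : ι → ℤ) t, ψ ((fun i ↦ (c i : ℝ)) + t) = ψ t)
    (A : Matrix.SpecialLinearGroup ι ℤ) (d : ι → ℝ) :
    ∫ t in unitCell ι, ψ ((A.1.map (Int.cast : ℤ → ℝ)) *ᵥ t + d) = ∫ t in unitCell ι, ψ t := by
  set T : (ι → ℝ) → (ι → ℝ) := fun t ↦ (A.1.map (Int.cast : ℤ → ℝ)) *ᵥ t + d with hT
  have hTc : Continuous T :=
    (Continuous.matrix_mulVec continuous_const continuous_id).add continuous_const
  let Te : (ι → ℝ) ≃ₜ (ι → ℝ) :=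
    { toFun := T
      invFun := fun t ↦ (A⁻¹.1.map (Int.cast : ℤ → ℝ)) *ᵥ (t - d)
      left_inv := fun t ↦ by
        simp only [hT, add_sub_cancel_right]
        rw [intCast_inv_mulVec_mulVec]
      right_inv := fun t ↦ by
        simp only [hT]
        rw [intCast_mulVec_inv_mulVec, sub_add_cancel]
      continuous_toFun := hTc
      continuous_invFun := Continuous.matrix_mulVec continuous_const
        (continuous_id.sub continuous_const) }
  have hTm : MeasurePreserving T := measurePreserving_intCast_mulVec_add A d
  let Λ := (Submodule.span ℤ (Set.range (Pi.basisFun ℝ ι))).toAddSubgroup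
  have hΛ (B : Matrix.SpecialLinearGroup ι ℤ) (v : Λ) :
      (B.1.map (Int.cast : ℤ → ℝ)) *ᵥ v.1 ∈ Λ := by
    obtain ⟨c, hc⟩ := (mem_span_basisFun_iff v.1).1 v.2
    exact (mem_span_basisFun_iff _).2 ⟨B.1 *ᵥ c, by rw [hc, intCast_mulVec]⟩
  let e : Λ → Λ := fun v ↦ ⟨_, hΛ A⁻¹ v⟩
  have he : Function.Bijective e := by
    refine Function.bijective_iff_has_inverse.2 ⟨fun v ↦ ⟨_, hΛ A v⟩, fun v ↦ ?_, fun v ↦ ?_⟩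
    · exact Subtype.ext (intCast_mulVec_inv_mulVec A v.1)
    · exact Subtype.ext (intCast_inv_mulVec_mulVec A v.1)
  have hD : IsAddFundamentalDomain Λ (unitCell ι) volume :=
    ZSpan.isAddFundamentalDomain' (Pi.basisFun ℝ ι) volume
  -- `T` is compatible with an automorphism of the lattice, so the preimage of the cell is again a
  -- fundamental domain. The periodic function ψ ∘ `T` has the same integral over both domains, and
  -- `T` preserves volume.
  have hD' : IsAddFundamentalDomain Λ (T ⁻¹' unitCell ι) volume := by
    refine hD.preimage_of_equiv hTm.quasiMeasurePreserving he fun v t ↦ ?_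
    change (A.1.map (Int.cast : ℤ → ℝ)) *ᵥ ((A⁻¹.1.map (Int.cast : ℤ → ℝ)) *ᵥ v.1 + t) + d =
      v.1 + ((A.1.map (Int.cast : ℤ → ℝ)) *ᵥ t + d)
    rw [Matrix.mulVec_add, intCast_mulVec_inv_mulVec, add_assoc]
  have : Countable Λ :=
    inferInstanceAs (Countable (Submodule.span ℤ (Set.range (Pi.basisFun ℝ ι))))
  rw [hD.setIntegral_eq hD' (f := fun t ↦ ψ (T t)), hTm.setIntegral_preimage_emb
    Te.measurableEmbedding ψ]
  intro v t
  obtain ⟨c, hc⟩ := (mem_span_basisFun_iff v.1).1 v.2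
  change ψ ((A.1.map (Int.cast : ℤ → ℝ)) *ᵥ (v.1 + t) + d) = ψ (T t)
  rw [Matrix.mulVec_add, hc, intCast_mulVec, add_assoc, hψ]

end PeriodicAverages

/-! ### Averages depending on a parameter -/

section ParametricAverages

set_option maxSynthPendingDepth 3

open MeasureTheory

variable {ι : Type*} [Fintype ι] {E : Type*} [NormedAddCommGroup E] [NormedSpace ℝ E]
  {G : Type*} [NormedAddCommGroup G]

lemma integrableOn_unitCell {f : (ι → ℝ) → G} (hf : Continuous f) :
    IntegrableOn f (unitCell ι) :=
  (hf.continuousOn.integrableOn_compact isCompact_closure_unitCell).mono_set subset_closure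

variable [NormedSpace ℝ G]

lemma setIntegral_unitCell_pos {f : (ι → ℝ) → ℝ} (hf : Continuous f) (hpos : ∀ t, 0 < f t) :
    0 < ∫ t in unitCell ι, f t := by
  rw [setIntegral_pos_iff_support_of_nonneg_ae (ae_of_all _ fun t ↦ (hpos t).le)
    (integrableOn_unitCell hf), Function.support_eq_univ fun t ↦ (hpos t).ne', Set.univ_inter,
    volume_unitCell]
  exact one_pos

/-- Differentiation under the integral sign: the derivative is bounded on the compact product of a
small closed ball and the closed cell. -/
lemma hasFDerivAt_setIntegral_unitCell [FiniteDimensional ℝ E] {H : Set E} (hH : IsOpen H)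
    {K : E → G} (hK : ContDiffOn ℝ 1 K H) (L : (ι → ℝ) →L[ℝ] E)
    (hL : ∀ p ∈ H, ∀ t, p + L t ∈ H) {p : E} (hp : p ∈ H) :
    HasFDerivAt (fun q ↦ ∫ t in unitCell ι, K (q + L t))
      (∫ t in unitCell ι, fderiv ℝ K (p + L t)) p := by
  have : ProperSpace E := FiniteDimensional.proper ℝ E
  obtain ⟨ε, hε, hball⟩ := Metric.nhds_basis_closedBall.mem_iff.1 (hH.mem_nhds hp)
  have hKc : ContinuousOn (fderiv ℝ K) H := hK.continuousOn_fderiv_of_isOpen hH le_rfl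
  have hcont (q : E) (hq : q ∈ H) : Continuous fun t ↦ K (q + L t) :=
    hK.continuousOn.comp_continuous (by fun_prop) (hL q hq)
  have hcont' : ContinuousOn (fun x : E × (ι → ℝ) ↦ fderiv ℝ K (x.1 + L x.2))
      (Metric.closedBall p ε ×ˢ closure (unitCell ι)) :=
    hKc.comp (by fun_prop) fun x hx ↦ hL _ (hball hx.1) _
  obtain ⟨C, hC⟩ := ((isCompact_closedBall p ε).prod
    isCompact_closure_unitCell).exists_bound_of_continuousOn hcont'
  refine hasFDerivAt_integral_of_dominated_of_fderiv_le (bound := fun _ ↦ C)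
    (F' := fun q t ↦ fderiv ℝ K (q + L t)) (Metric.closedBall_mem_nhds p hε) ?_ ?_ ?_ ?_ ?_ ?_
  · filter_upwards [hH.mem_nhds hp] with q hq using (hcont q hq).aestronglyMeasurable
  · exact integrableOn_unitCell (hcont p hp)
  · exact (hKc.comp_continuous (f := fun t ↦ p + L t) (by fun_prop)
      (hL p hp)).aestronglyMeasurable
  · filter_upwards [ae_restrict_mem measurableSet_unitCell] with t ht q hq
    exact hC (q, t) ⟨hq, subset_closure ht⟩
  · exact integrableOn_unitCell continuous_const
  · refine ae_of_all _ fun t q hq ↦ ?_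
    have h := ((hK.differentiableOn one_ne_zero).differentiableAt
      (hH.mem_nhds (hL q (hball hq) t))).hasFDerivAt
    exact h.comp q ((hasFDerivAt_id q).add_const (L t))

end ParametricAverages

/-! ### The lattice, the dilation and their linear algebra -/

namespace EndoPajitnovData

section LinearMaps

set_option maxSynthPendingDepth 3

variable {n : ℕ} (D : EndoPajitnovData n)

/-- The translation part `∑ t_i u_i` of the deck transformations, as a vector of `ℂ × ℂⁿ`. -/
def latticeMap : (Fin (2 * n + 1) → ℝ) →L[ℝ] ℂ × (Fin n → ℂ) :=
  LinearMap.toContinuousLinearMap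
    (((Complex.ofRealCLM : ℝ →ₗ[ℝ] ℂ).prodMap LinearMap.id) ∘ₗ D.latticeVec)

lemma latticeMap_apply (t : Fin (2 * n + 1) → ℝ) :
    D.latticeMap t = (((D.latticeVec t).1 : ℂ), (D.latticeVec t).2) := rfl

lemma im_latticeMap (t : Fin (2 * n + 1) → ℝ) : (D.latticeMap t).1.im = 0 :=
  Complex.ofReal_im _

/-- The 2n + 1 independent vectors u_i span the (2n + 1)-dimensional real space ℝ × ℂⁿ. Invariance
under their real combinations therefore leaves only the dependence on Im w. -/
lemma exists_latticeMap_eq {p : ℂ × (Fin n → ℂ)} (hp : p.1.im = 0) :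
    ∃ t, D.latticeMap t = p := by
  have hsurj : Function.Surjective D.latticeVec := by
    refine (LinearMap.injective_iff_surjective_of_finrank_eq_finrank ?_).1 D.latticeVec_injective
    simp [Module.finrank_pi_fintype, Complex.finrank_real_complex]
    ring
  obtain ⟨t, ht⟩ := hsurj (p.1.re, p.2)
  refine ⟨t, ?_⟩
  rw [latticeMap_apply, ht]
  exact Prod.ext (Complex.ext rfl hp.symm) rfl

/-- The linear map `(w, z) ↦ (α w, Rᵀ z)`. -/
def dilation : (ℂ × (Fin n → ℂ)) →L[ℝ] ℂ × (Fin n → ℂ) :=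
  (D.α • ContinuousLinearMap.id ℝ ℂ).prodMap
    (LinearMap.toContinuousLinearMap (D.Rᵀ.mulVecLin.restrictScalars ℝ))

lemma dilation_apply (p : ℂ × (Fin n → ℂ)) : D.dilation p = (D.α • p.1, D.Rᵀ *ᵥ p.2) := rfl

/-- The equation for `a` and the definition of `R` describe the same action of M on coefficients.
Allowing real coefficients, the dilation acts on the torus through Mᵀ. -/
lemma dilation_latticeMap (t : Fin (2 * n + 1) → ℝ) :
    D.dilation (D.latticeMap t) = D.latticeMap ((D.M.transpose.1.map (Int.cast : ℤ → ℝ)) *ᵥ t) := by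
  rw [dilation_apply, latticeMap_apply, latticeMap_apply]
  refine Prod.ext ?_ ?_
  · have ha : ∀ i, D.α * D.a i = ∑ l, (D.M.1 i l : ℝ) * D.a l := fun i ↦ by
      have := congrFun D.mul_a i
      simp [Matrix.mulVec, dotProduct] at this
      exact this.symm
    have key : D.α * (D.latticeVec t).1 =
        (D.latticeVec ((D.M.transpose.1.map (Int.cast : ℤ → ℝ)) *ᵥ t)).1 := by
      simp only [latticeVec_fst, Matrix.mulVec, dotProduct, Matrix.SpecialLinearGroup.coe_transpose,
        Matrix.map_apply, Matrix.transpose_apply, Finset.mul_sum, Finset.sum_mul]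
      rw [Finset.sum_comm]
      refine Finset.sum_congr rfl fun i _ ↦ ?_
      rw [mul_left_comm, ha, Finset.mul_sum]
      exact Finset.sum_congr rfl fun l _ ↦ by ring
    exact (by rw [← key, Complex.ofReal_mul, Complex.real_smul])
  · ext j
    simp only [latticeVec_snd, Matrix.mulVec, dotProduct, Matrix.SpecialLinearGroup.coe_transpose,
      Matrix.map_apply, Matrix.transpose_apply, Complex.ofReal_sum, Complex.ofReal_mul,
      Complex.ofReal_intCast, Finset.mul_sum, Finset.sum_mul]
    rw [Finset.sum_comm]
    rw [Finset.sum_comm (f := fun i l ↦ (D.M.1 l i : ℂ) * (t l : ℂ) * (D.b j).1 i)]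
    refine Finset.sum_congr rfl fun i _ ↦ ?_
    have h := congrArg (fun r ↦ (t i : ℂ) * r) (D.mulVec_b j i)
    simp only [Finset.mul_sum] at h
    convert h using 2 <;> ring

/-- The number 1 is real and different from α, hence not an eigenvalue. -/
lemma eq_zero_of_mulVec_eq_self {x : Fin (2 * n + 1) → ℝ}
    (hx : (D.M.1.map (Int.cast : ℤ → ℝ)) *ᵥ x = x) : x = 0 := by
  by_contra h
  have h1 : (complexMul D.M).HasEigenvalue 1 := by
    refine Module.End.hasEigenvalue_of_hasEigenvector (x := fun i ↦ (x i : ℂ))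
      ⟨Module.End.mem_eigenspace_iff.2 ?_, fun h0 ↦ h ?_⟩
    · ext i
      have := congrArg (fun r : ℝ ↦ (r : ℂ)) (congrFun hx i)
      simp [Matrix.mulVec, dotProduct] at this
      simp [complexMul, Matrix.mulVec, dotProduct, this]
    · ext i
      simpa using congrFun h0 i
  exact D.im_ne_zero 1 h1 (fun h2 ↦ D.α_ne_one (by exact_mod_cast h2.symm)) Complex.one_im

/-- The lattice has no non-zero real characters that are invariant under `M`. -/
lemma eq_zero_of_forall_vecMul (χ : (Fin (2 * n + 1) → ℤ) →+ ℝ)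
    (hχ : ∀ c, χ (D.M.transpose.1 *ᵥ c) = χ c) : χ = 0 := by
  have hsum (c : Fin (2 * n + 1) → ℤ) : χ c = ∑ i, c i * χ (Pi.single i 1) := by
    conv_lhs => rw [← Finset.univ_sum_single c]
    rw [map_sum]
    refine Finset.sum_congr rfl fun i _ ↦ ?_
    rw [show Pi.single i (c i) = c i • (Pi.single i 1 : Fin (2 * n + 1) → ℤ) by
      rw [← Pi.single_smul]; simp, map_zsmul, zsmul_eq_mul]
  -- Invariance of χ under Mᵀ says that the vector of its values on the standard basis is fixed by
  -- M.
  have h0 : (fun i ↦ χ (Pi.single i 1)) = 0 := by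
    refine D.eq_zero_of_mulVec_eq_self ?_
    ext i
    have h1 := hχ (Pi.single i 1)
    rw [hsum] at h1
    rw [← h1]
    simp [Matrix.mulVec, dotProduct, Pi.single_apply]
  refine DFunLike.ext _ _ fun c ↦ ?_
  rw [hsum]
  exact Finset.sum_eq_zero fun i _ ↦ by rw [show χ (Pi.single i 1) = 0 from congrFun h0 i, mul_zero]

/-- An eigenvector of M for β lies in W, so β is an eigenvalue of `R`, and `R` has the same
characteristic polynomial as its transpose. -/
lemma exists_eigenvector_transpose {β : ℂ} (hβ : 0 < β.im)
    (h : (complexMul D.M).HasEigenvalue β) : ∃ z, z ≠ 0 ∧ D.Rᵀ *ᵥ z = β • z := by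
  obtain ⟨x, hx⟩ := h.exists_hasEigenvector
  have hxW : x ∈ upperEigenspace D.M :=
    Submodule.mem_iSup_of_mem (p := fun β : {β : ℂ // 0 < β.im} ↦
      (complexMul D.M).maxGenEigenspace β) ⟨β, hβ⟩
      ((Module.End.mem_maxGenEigenspace _ _ _).2 ⟨1, by
        simpa [sub_eq_zero] using hx.apply_eq_smul⟩)
  have h1 : Module.End.HasEigenvalue (restrictUpper D.M) β := by
    refine Module.End.hasEigenvalue_of_hasEigenvector (x := (⟨x, hxW⟩ : upperEigenspace D.M))
      ⟨Module.End.mem_eigenspace_iff.2 (Subtype.ext hx.apply_eq_smul), fun h0 ↦ hx.2 ?_⟩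
    exact congrArg Subtype.val h0
  rw [Module.End.hasEigenvalue_iff_isRoot_charpoly, ← LinearMap.charpoly_toMatrix _ D.b,
    ← Matrix.charpoly_transpose, ← Matrix.charpoly_toLin',
    ← Module.End.hasEigenvalue_iff_isRoot_charpoly] at h1
  obtain ⟨z, hz⟩ := h1.exists_hasEigenvector
  exact ⟨z, hz.2, by simpa [R] using hz.apply_eq_smul⟩

end LinearMaps

end EndoPajitnovData

/-- The half-space `ℍ × ℂⁿ` as a subset of `ℂ × ℂⁿ`. -/
def upperHalfSpace (n : ℕ) : Set (ℂ × (Fin n → ℂ)) := {p | 0 < p.1.im}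

lemma isOpen_upperHalfSpace (n : ℕ) : IsOpen (upperHalfSpace n) :=
  isOpen_lt continuous_const (Complex.continuous_im.comp continuous_fst)

lemma convex_upperHalfSpace (n : ℕ) : Convex ℝ (upperHalfSpace n) :=
  (convex_halfSpace_im_gt 0).is_linear_preimage
    (f := fun p : ℂ × (Fin n → ℂ) ↦ p.1) (IsLinearMap.mk (fun _ _ ↦ rfl) fun _ _ ↦ rfl)

/-! ### Averaging a homothetic Kähler form over the torus -/

namespace EndoPajitnovData

section InvariantForms

set_option maxSynthPendingDepth 3

open MeasureTheory

variable {n : ℕ} (D : EndoPajitnovData n)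

lemma add_latticeMap_mem {p : ℂ × (Fin n → ℂ)} (hp : p ∈ upperHalfSpace n)
    (t : Fin (2 * n + 1) → ℝ) : p + D.latticeMap t ∈ upperHalfSpace n := by
  have : (p + D.latticeMap t).1.im = p.1.im := by
    rw [Prod.fst_add, Complex.add_im, im_latticeMap, add_zero]
  rw [upperHalfSpace, Set.mem_ofPred_eq, this]
  exact hp

lemma dilation_mem {p : ℂ × (Fin n → ℂ)} (hp : p ∈ upperHalfSpace n) :
    D.dilation p ∈ upperHalfSpace n := by
  have : (D.dilation p).1.im = D.α * p.1.im := by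
    rw [dilation_apply, Complex.smul_im, smul_eq_mul]
  rw [upperHalfSpace, Set.mem_ofPred_eq, this]
  exact mul_pos D.α_pos hp

/-- The data of a closed positive two-form on `ℍ × ℂⁿ` that is invariant under the lattice of
translations and homothetic under the dilation. -/
structure IsHomotheticKahlerForm (K : ℂ × (Fin n → ℂ) →
    (ℂ × (Fin n → ℂ)) →L[ℝ] (ℂ × (Fin n → ℂ)) →L[ℝ] ℝ) (κ : ℝ) : Prop where
  contDiffOn : ContDiffOn ℝ 1 K (upperHalfSpace n)
  alt : ∀ p ∈ upperHalfSpace n, ∀ u, K p u u = 0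
  pos : ∀ p ∈ upperHalfSpace n, ∀ u, u ≠ 0 → 0 < K p u (Complex.I • u)
  closed : ∀ p ∈ upperHalfSpace n, IsLeeFormAt K p 0
  translation : ∀ p ∈ upperHalfSpace n, ∀ c : Fin (2 * n + 1) → ℤ,
    K (p + D.latticeMap fun i ↦ (c i : ℝ)) = K p
  dilation : ∀ p ∈ upperHalfSpace n, ∀ u v,
    K (D.dilation p) (D.dilation u) (D.dilation v) = κ * K p u v

variable {D}

lemma IsHomotheticKahlerForm.normSq_eigenvalue_eq {K : ℂ × (Fin n → ℂ) →
    (ℂ × (Fin n → ℂ)) →L[ℝ] (ℂ × (Fin n → ℂ)) →L[ℝ] ℝ} {κ : ℝ}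
    (hK : D.IsHomotheticKahlerForm K κ) {β : ℂ} (hβ : 0 < β.im)
    (h : (complexMul D.M).HasEigenvalue β) : Complex.normSq β = κ := by
  let H := upperHalfSpace n
  have hH : IsOpen H := isOpen_upperHalfSpace n
  have hL : ∀ p ∈ H, ∀ t, p + D.latticeMap t ∈ H := fun p hp t ↦ D.add_latticeMap_mem hp t
  let B : ℂ × (Fin n → ℂ) → (ℂ × (Fin n → ℂ)) →L[ℝ] (ℂ × (Fin n → ℂ)) →L[ℝ] ℝ := fun p ↦
    ∫ t in unitCell (Fin (2 * n + 1)), K (p + D.latticeMap t)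
  have hcont (p) (hp : p ∈ H) : Continuous fun t ↦ K (p + D.latticeMap t) :=
    hK.contDiffOn.continuousOn.comp_continuous (by fun_prop) (hL p hp)
  have hBapply (p) (hp : p ∈ H) (u v) :
      B p u v = ∫ t in unitCell (Fin (2 * n + 1)), K (p + D.latticeMap t) u v := by
    have hi := integrableOn_unitCell (hcont p hp)
    rw [ContinuousLinearMap.integral_apply hi, ContinuousLinearMap.integral_apply]
    exact hi.apply_continuousLinearMap u
  have hper (p) (hp : p ∈ H) (c : Fin (2 * n + 1) → ℤ) (t : Fin (2 * n + 1) → ℝ) :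
      K (p + D.latticeMap ((fun i ↦ (c i : ℝ)) + t)) = K (p + D.latticeMap t) := by
    rw [map_add, add_comm (D.latticeMap _), ← add_assoc]
    exact hK.translation _ (hL p hp t) c
  have hBd (p) (hp : p ∈ H) : HasFDerivAt B
      (∫ t in unitCell (Fin (2 * n + 1)), fderiv ℝ K (p + D.latticeMap t)) p :=
    hasFDerivAt_setIntegral_unitCell hH hK.contDiffOn D.latticeMap hL hp
  -- the average is invariant under all real translations
  have hBtrans (p) (hp : p ∈ H) (d : Fin (2 * n + 1) → ℝ) : B (p + D.latticeMap d) = B p := by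
    have h1 := setIntegral_unitCell_comp_affine (ψ := fun t ↦ K (p + D.latticeMap t)) (hper p hp) 1 d
    refine Eq.trans (setIntegral_congr_fun measurableSet_unitCell fun t _ ↦ ?_) h1
    simp only [Matrix.SpecialLinearGroup.coe_one,
      Matrix.map_one _ Int.cast_zero Int.cast_one, Matrix.one_mulVec]
    rw [map_add, add_comm (D.latticeMap t), add_assoc]
  have hBd0 (p) (hp : p ∈ H) (u : ℂ × (Fin n → ℂ)) (hu : u.1.im = 0) : fderiv ℝ B p u = 0 := by
    obtain ⟨d, rfl⟩ := D.exists_latticeMap_eq hu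
    have h1 : HasDerivAt (fun s : ℝ ↦ p + s • D.latticeMap d) (D.latticeMap d) 0 := by
      simpa using ((hasDerivAt_id (0 : ℝ)).smul_const (D.latticeMap d)).const_add p
    have h2 : HasFDerivAt B (fderiv ℝ B p) (p + (0 : ℝ) • D.latticeMap d) := by
      rw [zero_smul, add_zero]; exact (hBd p hp).differentiableAt.hasFDerivAt
    have h3 := h2.comp_hasDerivAt 0 h1
    have h4 : (B ∘ fun s : ℝ ↦ p + s • D.latticeMap d) = fun _ ↦ B p := by
      funext s
      rw [Function.comp_apply, ← map_smul]
      exact hBtrans p hp _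
    rw [h4] at h3
    exact h3.unique (hasDerivAt_const _ _)
  -- the average is closed
  have hBclosed (p) (hp : p ∈ H) (a b c) :
      fderiv ℝ B p a b c + fderiv ℝ B p b c a + fderiv ℝ B p c a b = 0 := by
    have hci : Integrable (fun t ↦ fderiv ℝ K (p + D.latticeMap t))
        (volume.restrict (unitCell (Fin (2 * n + 1)))) :=
      integrableOn_unitCell ((hK.contDiffOn.continuousOn_fderiv_of_isOpen hH
        le_rfl).comp_continuous (by fun_prop) (hL p hp))
    have hev (a b c) : fderiv ℝ B p a b c =
        ∫ t in unitCell (Fin (2 * n + 1)), fderiv ℝ K (p + D.latticeMap t) a b c := by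
      rw [(hBd p hp).fderiv, ContinuousLinearMap.integral_apply hci,
        ContinuousLinearMap.integral_apply (hci.apply_continuousLinearMap a),
        ContinuousLinearMap.integral_apply
          ((hci.apply_continuousLinearMap a).apply_continuousLinearMap b)]
    have hint (a b c) : Integrable (fun t ↦ fderiv ℝ K (p + D.latticeMap t) a b c)
        (volume.restrict (unitCell (Fin (2 * n + 1)))) :=
      ((hci.apply_continuousLinearMap a).apply_continuousLinearMap b).apply_continuousLinearMap c
    rw [hev, hev, hev, ← integral_add (hint a b c) (hint b c a),
      ← integral_add ((hint a b c).fun_add (hint b c a)) (hint c a b)]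
    refine integral_eq_zero_of_ae (ae_of_all _ fun t ↦ ?_)
    simpa using hK.closed _ (hL p hp t) a b c
  -- hence the average is constant on `ℂⁿ`
  have hBconst (u v : Fin n → ℂ) (p) (hp : p ∈ H) (q) (hq : q ∈ H) :
      B p (0, u) (0, v) = B q (0, u) (0, v) := by
    have hd (p) (hp : p ∈ H) : HasFDerivAt (fun p ↦ B p (0, u) (0, v)) (0 : _ →L[ℝ] ℝ) p := by
      have h1 := ((hBd p hp).differentiableAt.hasFDerivAt.clm_apply
        (hasFDerivAt_const ((0, u) : ℂ × (Fin n → ℂ)) p)).clm_apply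
        (hasFDerivAt_const ((0, v) : ℂ × (Fin n → ℂ)) p)
      refine h1.congr_fderiv (ContinuousLinearMap.ext fun a ↦ ?_)
      -- Of the three terms of dB(a, u, v), those differentiating along u and v vanish by
      -- translation invariance, so the derivative along a vanishes too.
      have h2 := hBclosed p hp a (0, u) (0, v)
      rw [hBd0 p hp (0, u) rfl, hBd0 p hp (0, v) rfl] at h2
      simpa using h2
    exact (convex_upperHalfSpace n).is_const_of_fderivWithin_eq_zero (𝕜 := ℝ)
      (f := fun p ↦ B p (0, u) (0, v))
      (fun q hq ↦ (hd q hq).differentiableAt.differentiableWithinAt)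
      (fun q hq ↦ by rw [fderivWithin_of_isOpen hH hq, (hd q hq).fderiv]) hp hq
  have hBdil (p) (hp : p ∈ H) (u v) :
      B (D.dilation p) (D.dilation u) (D.dilation v) = κ * B p u v := by
    have h1 : B (D.dilation p) = ∫ t in unitCell (Fin (2 * n + 1)),
        K (D.dilation (p + D.latticeMap t)) := by
      -- The dilation changes the integration variable by Mᵀ, an automorphism of the torus, so
      -- averaging commutes with it.
      have h2 := setIntegral_unitCell_comp_affine (ψ := fun t ↦ K (D.dilation p + D.latticeMap t))
        (hper _ (D.dilation_mem hp)) D.M.transpose 0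
      refine h2.symm.trans (setIntegral_congr_fun measurableSet_unitCell fun t _ ↦ ?_)
      simp only [add_zero]
      rw [← dilation_latticeMap, ← map_add]
    have hcd : Continuous fun t ↦ K (D.dilation (p + D.latticeMap t)) :=
      hK.contDiffOn.continuousOn.comp_continuous (by fun_prop) fun t ↦ D.dilation_mem (hL p hp t)
    have hi := integrableOn_unitCell hcd
    rw [h1, ContinuousLinearMap.integral_apply hi,
      ContinuousLinearMap.integral_apply (hi.apply_continuousLinearMap _), hBapply p hp,
      ← integral_const_mul]
    exact setIntegral_congr_fun measurableSet_unitCell fun t _ ↦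
      hK.dilation _ (hL p hp t) u v
  have hBalt (p) (hp : p ∈ H) (u) : B p u u = 0 := by
    rw [hBapply p hp]
    exact integral_eq_zero_of_ae (ae_of_all _ fun t ↦ hK.alt _ (hL p hp t) u)
  have hBpos (p) (hp : p ∈ H) (u) (hu : u ≠ 0) : 0 < B p u (Complex.I • u) := by
    rw [hBapply p hp]
    exact setIntegral_unitCell_pos (((hcont p hp).clm_apply continuous_const).clm_apply
      continuous_const) fun t ↦ hK.pos _ (hL p hp t) u hu
  obtain ⟨z, hz0, hz⟩ := D.exists_eigenvector_transpose hβ h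
  let p : ℂ × (Fin n → ℂ) := (Complex.I, 0)
  have hp : p ∈ H := by simp [p, H, upperHalfSpace]
  have hz1 : D.dilation (0, z) = β.re • ((0, z) : ℂ × (Fin n → ℂ)) +
      β.im • (Complex.I • (0, z) : ℂ × (Fin n → ℂ)) := by
    rw [dilation_apply, hz]
    refine Prod.ext (by simp) ?_
    ext i
    simp only [Pi.smul_apply, Prod.snd_add, Prod.smul_snd, Pi.add_apply, Complex.real_smul,
      smul_eq_mul]
    conv_lhs => rw [← Complex.re_add_im β]
    ring
  have hz2 : D.dilation (0, Complex.I • z) = β.re • (Complex.I • (0, z) : ℂ × (Fin n → ℂ)) -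
      β.im • ((0, z) : ℂ × (Fin n → ℂ)) := by
    rw [dilation_apply, Matrix.mulVec_smul, hz]
    refine Prod.ext (by simp) ?_
    ext i
    simp only [Pi.smul_apply, Prod.snd_sub, Prod.smul_snd, Pi.sub_apply, Complex.real_smul,
      smul_eq_mul]
    conv_lhs => rw [← Complex.re_add_im β]
    linear_combination (β.im : ℂ) * z i * Complex.I_mul_I
  have hI : ((0, Complex.I • z) : ℂ × (Fin n → ℂ)) = Complex.I • (0, z) :=
    Prod.ext (by simp) rfl
  have h1 := hBdil p hp (0, z) (0, Complex.I • z)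
  have h2 : B (D.dilation p) (D.dilation (0, z)) (D.dilation (0, Complex.I • z)) =
      B p (D.dilation (0, z)) (D.dilation (0, Complex.I • z)) := by
    have h3 (w : Fin n → ℂ) : D.dilation (0, w) = (0, D.Rᵀ *ᵥ w) :=
      Prod.ext (smul_zero D.α) rfl
    rw [h3, h3]
    exact hBconst _ _ _ (D.dilation_mem hp) _ hp
  rw [h2, hz1, hz2, hI] at h1
  -- On the real plane spanned by z and iz, multiplication by β has determinant |β|². An alternating
  -- form is scaled by this factor, so invariance of B under J is not needed.
  have hanti : B p (Complex.I • (0, z)) (0, z) = -B p (0, z) (Complex.I • (0, z)) := by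
    have := hBalt p hp ((0, z) + Complex.I • (0, z))
    simp only [map_add, add_apply, hBalt p hp] at this
    linarith
  have hpos := hBpos p hp (0, z) fun h0 ↦ hz0 (congrArg Prod.snd h0)
  simp only [map_add, map_sub, map_smul, add_apply, smul_apply, smul_eq_mul, hBalt p hp,
    hanti] at h1
  refine mul_right_cancel₀ hpos.ne' ?_
  rw [← h1, Complex.normSq_apply]
  ring

end InvariantForms

end EndoPajitnovData

/-! ### From locally conformally Kähler to homothetic Kähler -/

namespace EndoPajitnovData

section LocallyConformal

set_option maxSynthPendingDepth 3

variable {n : ℕ} (D : EndoPajitnovData n)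

/-- There is no invariant locally conformally Kähler form on `ℍ × ℂⁿ`. -/
theorem false_of_invariant_locally_conformal (hn : 1 < n) {W : ℂ × (Fin n → ℂ) →
      (ℂ × (Fin n → ℂ)) →L[ℝ] (ℂ × (Fin n → ℂ)) →L[ℝ] ℝ}
    (hW : ContDiffOn ℝ 1 W (upperHalfSpace n))
    (halt : ∀ p ∈ upperHalfSpace n, ∀ u, W p u u = 0)
    (hpos : ∀ p ∈ upperHalfSpace n, ∀ u, u ≠ 0 → 0 < W p u (Complex.I • u))
    (htrans : ∀ p ∈ upperHalfSpace n, ∀ c : Fin (2 * n + 1) → ℤ, ∀ u v,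
      W (p + D.latticeMap fun i ↦ (c i : ℝ)) u v = W p u v)
    (hdil : ∀ p ∈ upperHalfSpace n, ∀ u v,
      W (D.dilation p) (D.dilation u) (D.dilation v) = W p u v)
    (hloc : ∀ p ∈ upperHalfSpace n, ∃ f : ℂ × (Fin n → ℂ) → ℝ, ContDiffAt ℝ ∞ f p ∧
      ∀ᶠ q in 𝓝 p, IsLeeFormAt W q (fderiv ℝ f q)) : False := by
  let H := upperHalfSpace n
  have hH : IsOpen H := isOpen_upperHalfSpace n
  have hHc : Convex ℝ H := convex_upperHalfSpace n
  let J : (ℂ × (Fin n → ℂ)) →ₗ[ℝ] ℂ × (Fin n → ℂ) :=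
    (Complex.I • LinearMap.id : (ℂ × (Fin n → ℂ)) →ₗ[ℂ] _).restrictScalars ℝ
  have hposJ : ∀ p ∈ H, ∀ u, u ≠ 0 → 0 < W p u (J u) := hpos
  have hdim : 2 < Module.finrank ℝ (ℂ × (Fin n → ℂ)) := by
    simp [Module.finrank_pi_fintype, Complex.finrank_real_complex]
    omega
  obtain ⟨F, hF, hFW⟩ := exists_isLeeFormAt_fderiv hdim hH hHc halt hposJ hloc
  have hWd : DifferentiableOn ℝ W H := hW.differentiableOn one_ne_zero
  have hFd : DifferentiableOn ℝ F H := hF.differentiableOn one_ne_zero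
  have hlat (c : Fin (2 * n + 1) → ℤ) : ∃ χ : ℝ, ∀ p ∈ H,
      F (p + D.latticeMap fun i ↦ (c i : ℝ)) = F p + χ :=
    exists_forall_apply_affine_eq_add hdim hH hHc halt hposJ hWd hFd hFW
      (ContinuousLinearMap.id ℝ _) _ (fun p hp ↦ D.add_latticeMap_mem hp _)
      fun p hp ↦ htrans p hp c
  obtain ⟨s, hs⟩ : ∃ s : ℝ, ∀ p ∈ H, F (D.dilation p) = F p + s := by
    simpa using exists_forall_apply_affine_eq_add hdim hH hHc halt hposJ hWd hFd hFW
      D.dilation 0 (fun p hp ↦ by rw [add_zero]; exact D.dilation_mem hp)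
      fun p hp ↦ by rw [add_zero]; exact hdil p hp
  choose χ hχ using hlat
  have hp₀ : ((Complex.I, 0) : ℂ × (Fin n → ℂ)) ∈ H := by simp [H, upperHalfSpace]
  have hcast (c c' : Fin (2 * n + 1) → ℤ) : (fun i ↦ ((c + c') i : ℝ)) =
      (fun i ↦ (c i : ℝ)) + fun i ↦ (c' i : ℝ) := by
    ext i
    simp
  have hadd (c c') : χ (c + c') = χ c + χ c' := by
    have h1 := hχ (c + c') _ hp₀
    rw [hcast, map_add, ← add_assoc, hχ _ _ (D.add_latticeMap_mem hp₀ _), hχ _ _ hp₀] at h1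
    linarith
  -- Translating by c and then dilating equals dilating and then translating by Mᵀ c. Comparing the
  -- changes of `F`, the constant `s` cancels.
  have hinv (c) : χ (D.M.transpose.1 *ᵥ c) = χ c := by
    have h1 := hs _ (D.add_latticeMap_mem hp₀ fun i ↦ (c i : ℝ))
    rw [map_add, dilation_latticeMap, intCast_mulVec, hχ _ _ (D.dilation_mem hp₀), hχ _ _ hp₀,
      hs _ hp₀] at h1
    linarith
  have hχ0 (c) : χ c = 0 :=
    DFunLike.congr_fun (D.eq_zero_of_forall_vecMul (AddMonoidHom.mk' χ hadd) hinv) c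
  have hK : D.IsHomotheticKahlerForm (fun p ↦ Real.exp (-F p) • W p) (Real.exp (-s)) :=
    { contDiffOn := (Real.contDiff_exp.comp_contDiffOn hF.neg).smul hW
      alt := fun p hp u ↦ by simp [halt p hp]
      pos := fun p hp u hu ↦ mul_pos (Real.exp_pos _) (hpos p hp u hu)
      closed := fun p hp ↦ (isLeeFormAt_exp_neg_smul_zero_iff
        (hWd.differentiableAt (hH.mem_nhds hp)) (hFd.differentiableAt (hH.mem_nhds hp))).2
        (hFW p hp)
      translation := fun p hp c ↦ by
        ext u v <;>
        simp [hχ c p hp, hχ0, htrans p hp]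
      dilation := fun p hp u v ↦ by
        simp only [hs p hp, smul_apply, hdil p hp, smul_eq_mul]
        rw [neg_add, Real.exp_add]
        ring }
  exact D.not_forall_normSq_eigenvalue_eq hn (Real.exp (-s)) fun β hβ h ↦
    hK.normSq_eigenvalue_eq hβ h

end LocallyConformal

end EndoPajitnovData

/-! ### Bilinear forms and alternating forms of degree two -/

section AlternatingForms

set_option maxSynthPendingDepth 3

variable {E : Type*} [NormedAddCommGroup E] [NormedSpace ℝ E]

/-- Alternatization is continuous and linear and doubles a form that is already alternating, whence
the factor 1/2. The map transfers differentiability from bilinear to alternating forms. -/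
lemma exists_clm_apply_eq_of_alt : ∃ T : (E →L[ℝ] E →L[ℝ] ℝ) →L[ℝ] E [⋀^Fin 2]→L[ℝ] ℝ,
    ∀ B, (∀ u, B u u = 0) → ∀ v, T B v = B (v 0) (v 1) := by
  let e : (E →L[ℝ] ℝ) ≃ₗᵢ[ℝ] E [⋀^Fin 1]→L[ℝ] ℝ := ContinuousAlternatingMap.ofSubsingletonLIE 0
  let S : (E →L[ℝ] ℝ) →L[ℝ] E [⋀^Fin 1]→L[ℝ] ℝ := e.toContinuousLinearEquiv
  refine ⟨(1 / 2 : ℝ) • (ContinuousAlternatingMap.alternatizeUncurryFinCLM ℝ E ℝ ∘L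
    ContinuousLinearMap.postcomp E S), fun B hB v ↦ ?_⟩
  have hanti : B (v 1) (v 0) = -B (v 0) (v 1) := by
    have := hB (v 0 + v 1)
    simp only [map_add, add_apply, hB] at this
    linarith
  have h1 (u w : E) : S (B u) (fun _ ↦ w) = B u w := rfl
  have h2 (w : Fin 1 → E) : w = fun _ ↦ w 0 := funext fun i ↦ by rw [Subsingleton.elim i 0]
  change (1 / 2 : ℝ) • (ContinuousAlternatingMap.alternatizeUncurryFin (S ∘L B)) v = _
  rw [ContinuousAlternatingMap.alternatizeUncurryFin_apply, Fin.sum_univ_two,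
    h2 (Fin.removeNth 0 v), h2 (Fin.removeNth 1 v)]
  simp only [ContinuousLinearMap.comp_apply, h1]
  have h3 : Fin.removeNth 0 v 0 = v 1 := rfl
  have h4 : Fin.removeNth 1 v 0 = v 0 := rfl
  rw [h3, h4, hanti]
  simp
  ring

lemma differentiableAt_of_apply_eq {K : E → E →L[ℝ] E →L[ℝ] ℝ} {Φ : E → E [⋀^Fin 2]→L[ℝ] ℝ}
    (hΦ : ∀ y v, Φ y v = K y (v 0) (v 1)) {q : E} (hK : DifferentiableAt ℝ K q) :
    DifferentiableAt ℝ Φ q := by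
  obtain ⟨T, hT⟩ := exists_clm_apply_eq_of_alt (E := E)
  have h : Φ = fun y ↦ T (K y) := by
    funext y
    ext v
    rw [hΦ, hT]
    intro u
    have h1 := hΦ y (fun _ ↦ u)
    rw [← h1]
    exact (Φ y).map_eq_zero_of_eq _ rfl Fin.zero_ne_one
  rw [h]
  exact T.differentiableAt.comp q hK

/-- Antisymmetry turns the middle term of the alternating sum defining the exterior derivative into
the middle term of the cyclic sum. -/
lemma isLeeFormAt_zero_of_extDeriv_eq_zero {K : E → E →L[ℝ] E →L[ℝ] ℝ}
    {Φ : E → E [⋀^Fin 2]→L[ℝ] ℝ} (hΦ : ∀ y v, Φ y v = K y (v 0) (v 1)) {q : E}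
    (hK : DifferentiableAt ℝ K q) (h : extDeriv Φ q = 0) : IsLeeFormAt K q 0 := by
  intro a b c
  have hanti : (fun y ↦ K y a c) = fun y ↦ -K y c a := by
    funext y
    have halt (u : E) : K y u u = 0 := by
      rw [← hΦ y (fun _ ↦ u)]
      exact (Φ y).map_eq_zero_of_eq _ rfl Fin.zero_ne_one
    have := halt (a + c)
    simp only [map_add, add_apply, halt] at this
    linarith
  have hd (u v w : E) : fderiv ℝ (fun y ↦ K y u v) q w = fderiv ℝ K q w u v := by
    have h1 := (hK.hasFDerivAt.clm_apply (hasFDerivAt_const u q)).clm_apply (hasFDerivAt_const v q)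
    rw [h1.fderiv]
    simp
  have h1 := extDeriv_apply (differentiableAt_of_apply_eq hΦ hK) ![a, b, c]
  rw [h, Fin.sum_univ_three] at h1
  simp only [hΦ] at h1
  change 0 = (-1) ^ 0 • fderiv ℝ (fun y ↦ K y b c) q a +
    (-1) ^ 1 • fderiv ℝ (fun y ↦ K y a c) q b + (-1) ^ 2 • fderiv ℝ (fun y ↦ K y a b) q c at h1
  rw [hanti, fderiv_fun_neg, neg_apply, hd, hd, hd] at h1
  simp only [zero_apply, zero_mul, add_zero]
  rw [h1]
  simp

end AlternatingForms

/-! ### The projection to `T` and deck transformations -/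

namespace EndoPajitnovData

section Projection

set_option maxSynthPendingDepth 3

variable {n : ℕ} (D : EndoPajitnovData n)

variable (n) in
/-- The global chart of `ℍ × ℂⁿ`. -/
def coverChart : OpenPartialHomeomorph (ℍ × (Fin n → ℂ)) (ℂ × (Fin n → ℂ)) :=
  chartAt (ℂ × (Fin n → ℂ)) ((UpperHalfPlane.I, 0) : ℍ × (Fin n → ℂ))

lemma coe_coverChart : ⇑(coverChart n) = incl n := rfl

lemma coverChart_target : (coverChart n).target = upperHalfSpace n := by
  have h : (coverChart n).target = Set.range (incl n) := by
    have h1 := (coverChart n).image_source_eq_target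
    rw [← h1, coe_coverChart, ← Set.image_univ]
    rfl
  rw [h]
  ext p
  constructor
  · rintro ⟨q, rfl⟩
    exact q.1.im_pos
  · intro hp
    exact ⟨(⟨p.1, hp⟩, p.2), rfl⟩

lemma incl_coverChart_symm {y : ℂ × (Fin n → ℂ)} (hy : y ∈ upperHalfSpace n) :
    incl n ((coverChart n).symm y) = y :=
  (coverChart n).right_inv (coverChart_target ▸ hy)

lemma coverChart_symm_incl (p : ℍ × (Fin n → ℂ)) : (coverChart n).symm (incl n p) = p :=
  (coverChart n).left_inv (Set.mem_univ p)

/-- The projection `ℍ × ℂⁿ → T_M`, in the global chart of `ℍ × ℂⁿ`. -/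
def proj (y : ℂ × (Fin n → ℂ)) : D.T := Quotient.mk _ ((coverChart n).symm y)

lemma proj_incl (p : ℍ × (Fin n → ℂ)) : D.proj (incl n p) = Quotient.mk _ p := by
  rw [proj, coverChart_symm_incl]

lemma proj_incl_smul {γ : Equiv.Perm (ℍ × (Fin n → ℂ))} (hγ : γ ∈ D.G) (p : ℍ × (Fin n → ℂ)) :
    D.proj (incl n (γ p)) = D.proj (incl n p) := by
  rw [proj_incl, proj_incl]
  exact Quotient.sound (MulAction.orbitRel_apply.2 ⟨⟨γ, hγ⟩, rfl⟩)

lemma translation_mem_G (c : Fin (2 * n + 1) → ℤ) : translation (D.intVec c) ∈ D.G := by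
  let S : AddSubgroup (Fin (2 * n + 1) → ℤ) :=
    { carrier := {c | translation (D.intVec c) ∈ D.G}
      zero_mem' := by
        change translation (D.intVec 0) ∈ D.G
        rw [intVec, show (fun i ↦ (((0 : Fin (2 * n + 1) → ℤ) i : ℤ) : ℝ)) = 0 from
          funext fun _ ↦ Int.cast_zero, map_zero, translation_zero]
        exact one_mem _
      add_mem' := fun {a b} ha hb ↦ by
        change translation (D.intVec (a + b)) ∈ D.G
        rw [intVec_add, translation_add]
        exact mul_mem ha hb
      neg_mem' := fun {a} ha ↦ by
        change translation (D.intVec (-a)) ∈ D.G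
        have h : translation (D.intVec (-a)) = (translation (D.intVec a))⁻¹ := by
          rw [eq_inv_iff_mul_eq_one, ← translation_add, intVec_neg, neg_add_cancel,
            translation_zero]
        rw [h]
        exact inv_mem ha }
  change c ∈ S
  rw [← Finset.univ_sum_single c]
  refine sum_mem fun i _ ↦ ?_
  have h : Pi.single i (c i) = c i • (Pi.single i 1 : Fin (2 * n + 1) → ℤ) := by
    rw [← Pi.single_smul]; simp
  rw [h]
  refine zsmul_mem ?_ _
  change translation (D.intVec (Pi.single i 1)) ∈ D.G
  rw [intVec_single]
  exact Subgroup.subset_closure (Set.mem_insert_of_mem _ ⟨i, rfl⟩)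

lemma proj_add_latticeMap {p : ℂ × (Fin n → ℂ)} (hp : p ∈ upperHalfSpace n)
    (c : Fin (2 * n + 1) → ℤ) : D.proj (p + D.latticeMap fun i ↦ (c i : ℝ)) = D.proj p := by
  have h := D.proj_incl_smul (D.translation_mem_G c) ((coverChart n).symm p)
  rw [incl_coverChart_symm hp] at h
  rw [← h]
  congr 1
  have h1 (q : ℍ × (Fin n → ℂ)) : incl n (translation (D.intVec c) q) =
      incl n q + D.latticeMap fun i ↦ (c i : ℝ) :=
    Prod.ext (add_comm _ _) rfl
  rw [h1, incl_coverChart_symm hp]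

lemma proj_dilation {p : ℂ × (Fin n → ℂ)} (hp : p ∈ upperHalfSpace n) :
    D.proj (D.dilation p) = D.proj p := by
  have h := D.proj_incl_smul (Subgroup.subset_closure (Set.mem_insert D.g₀ _))
    ((coverChart n).symm p)
  rw [incl_coverChart_symm hp] at h
  rw [← h]
  congr 1
  have h1 (q : ℍ × (Fin n → ℂ)) : incl n (D.g₀ q) = D.dilation (incl n q) :=
    Prod.ext (by simp [incl, g₀, dilation_apply]) rfl
  rw [h1, incl_coverChart_symm hp]

/-- A chart is a local inverse of the quotient map followed by the global chart, so all inverse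
charts are the same total function, even off their targets. A form on `T` thus has one expression
for all charts. -/
lemma coe_symm_of_mem_atlas {e : OpenPartialHomeomorph D.T (ℂ × (Fin n → ℂ))}
    (he : e ∈ atlas (ℂ × (Fin n → ℂ)) D.T) : ⇑e.symm = D.proj := by
  obtain ⟨q, rfl⟩ := he
  funext y
  simp only [OpenPartialHomeomorph.coe_trans_symm, Function.comp_apply,
    IsLocalHomeomorph.localInverseAt_symm]
  rfl

lemma target_subset_of_mem_atlas {e : OpenPartialHomeomorph D.T (ℂ × (Fin n → ℂ))}
    (he : e ∈ atlas (ℂ × (Fin n → ℂ)) D.T) : e.target ⊆ upperHalfSpace n := by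
  obtain ⟨q, rfl⟩ := he
  rw [← coverChart_target]
  exact Set.inter_subset_left

lemma continuousOn_proj : ContinuousOn D.proj (upperHalfSpace n) :=
  continuous_quotient_mk'.comp_continuousOn (coverChart_target (n := n) ▸
    (coverChart n).continuousOn_symm)

/-- In the charts of `T_M`, the projection is given by deck transformations. -/
lemma exists_chart_proj_eventuallyEq {p : ℂ × (Fin n → ℂ)} (hp : p ∈ upperHalfSpace n)
    {e : OpenPartialHomeomorph D.T (ℂ × (Fin n → ℂ))} (he : e ∈ atlas (ℂ × (Fin n → ℂ)) D.T)
    (hpe : D.proj p ∈ e.source) :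
    ∃ A A' : ℂ × (Fin n → ℂ) → ℂ × (Fin n → ℂ), ContDiff ℂ ω A ∧ ContDiff ℂ ω A' ∧
      (∀ z ∈ upperHalfSpace n, A' (A z) = z) ∧ ∀ᶠ z in 𝓝 p, e (D.proj z) = A z := by
  have hcov : e (D.proj p) ∈ upperHalfSpace n :=
    D.target_subset_of_mem_atlas he (e.map_source hpe)
  have hsymm := D.coe_symm_of_mem_atlas he
  have hpp : D.proj (e (D.proj p)) = D.proj p :=
    (congrFun hsymm _).symm.trans (e.left_inv hpe)
  obtain ⟨γ, hγ⟩ : (coverChart n).symm (e (D.proj p)) ∈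
      MulAction.orbit D.G ((coverChart n).symm p) := Quotient.exact hpp
  obtain ⟨A, hA, hA'⟩ := D.exists_contDiff γ.2
  obtain ⟨B, hB, hB'⟩ := D.exists_contDiff (γ⁻¹).2
  have hAp (z : ℂ × (Fin n → ℂ)) (hz : z ∈ upperHalfSpace n) :
      incl n (γ.1 ((coverChart n).symm z)) = A z := by
    rw [hA', incl_coverChart_symm hz]
  refine ⟨A, B, hA, hB, fun z hz ↦ ?_, ?_⟩
  · rw [← hAp z hz, ← hB']
    have h1 : (γ⁻¹).1 (γ.1 ((coverChart n).symm z)) = (coverChart n).symm z :=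
      inv_smul_smul γ ((coverChart n).symm z)
    rw [h1, incl_coverChart_symm hz]
  · have hApt : A p ∈ e.target := by
      rw [← hAp p hp]
      have h1 : γ.1 ((coverChart n).symm p) = (coverChart n).symm (e (D.proj p)) := hγ
      rw [h1, incl_coverChart_symm hcov]
      exact e.map_source hpe
    filter_upwards [(isOpen_upperHalfSpace n).mem_nhds hp,
      hA.continuous.continuousAt.eventually_mem (e.open_target.mem_nhds hApt)] with z hz hzt
    have h1 : D.proj z = D.proj (A z) := by
      rw [← hAp z hz, D.proj_incl_smul γ.2, incl_coverChart_symm hz]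
    rw [h1, ← hsymm, e.right_inv hzt]

end Projection

end EndoPajitnovData

/-! ### The differential of the projection and the pulled-back form -/

namespace EndoPajitnovData

section Differential

set_option maxSynthPendingDepth 3

variable {n : ℕ} (D : EndoPajitnovData n)

lemma continuousAt_proj {p : ℂ × (Fin n → ℂ)} (hp : p ∈ upperHalfSpace n) :
    ContinuousAt D.proj p :=
  D.continuousOn_proj.continuousAt ((isOpen_upperHalfSpace n).mem_nhds hp)

lemma contMDiffAt_proj {p : ℂ × (Fin n → ℂ)} (hp : p ∈ upperHalfSpace n) :
    ContMDiffAt 𝓘(ℝ, ℂ × (Fin n → ℂ)) 𝓘(ℝ, ℂ × (Fin n → ℂ)) ω D.proj p := by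
  obtain ⟨A, -, hA, -, -, hAp⟩ := D.exists_chart_proj_eventuallyEq hp
    (chart_mem_atlas (ℂ × (Fin n → ℂ)) (D.proj p)) (mem_chart_source _ _)
  refine contMDiffAt_iff_target.2 ⟨D.continuousAt_proj hp, ?_⟩
  refine ((hA.restrict_scalars ℝ).contDiffAt.contMDiffAt).congr_of_eventuallyEq ?_
  filter_upwards [hAp] with z hz
  simpa using hz

/-- The differential of the projection `ℍ × ℂⁿ → T_M`, in the preferred charts of `T_M`. -/
def dproj (p : ℂ × (Fin n → ℂ)) : (ℂ × (Fin n → ℂ)) →L[ℝ] ℂ × (Fin n → ℂ) :=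
  mfderiv 𝓘(ℝ, ℂ × (Fin n → ℂ)) 𝓘(ℝ, ℂ × (Fin n → ℂ)) D.proj p

lemma hasMFDerivAt_proj {p : ℂ × (Fin n → ℂ)} (hp : p ∈ upperHalfSpace n) :
    HasMFDerivAt 𝓘(ℝ, ℂ × (Fin n → ℂ)) 𝓘(ℝ, ℂ × (Fin n → ℂ)) D.proj p (D.dproj p) :=
  ((D.contMDiffAt_proj hp).mdifferentiableAt (by simp)).hasMFDerivAt

/-- In the preferred chart the projection is locally a holomorphic deck transformation, so complex
linearity and injectivity of `dproj` can be read off from `A`. -/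
lemma dproj_eq_fderiv {p : ℂ × (Fin n → ℂ)} (hp : p ∈ upperHalfSpace n)
    {A : ℂ × (Fin n → ℂ) → ℂ × (Fin n → ℂ)} (hA : DifferentiableAt ℂ A p)
    (hAp : ∀ᶠ z in 𝓝 p, chartAt (ℂ × (Fin n → ℂ)) (D.proj p) (D.proj z) = A z) :
    D.dproj p = (fderiv ℂ A p).restrictScalars ℝ := by
  have h : HasMFDerivAt 𝓘(ℝ, ℂ × (Fin n → ℂ)) 𝓘(ℝ, ℂ × (Fin n → ℂ)) D.proj p
      ((fderiv ℂ A p).restrictScalars ℝ) := by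
    refine ⟨D.continuousAt_proj hp, ?_⟩
    refine HasFDerivAt.hasFDerivWithinAt ?_
    refine (hA.hasFDerivAt.restrictScalars ℝ).congr_of_eventuallyEq ?_
    filter_upwards [hAp] with z hz
    exact hz
  exact h.mfderiv

lemma dproj_I_smul {p : ℂ × (Fin n → ℂ)} (hp : p ∈ upperHalfSpace n) (u : ℂ × (Fin n → ℂ)) :
    D.dproj p (Complex.I • u) = Complex.I • D.dproj p u := by
  obtain ⟨A, -, hA, -, -, hAp⟩ := D.exists_chart_proj_eventuallyEq hp
    (chart_mem_atlas (ℂ × (Fin n → ℂ)) (D.proj p)) (mem_chart_source _ _)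
  rw [D.dproj_eq_fderiv hp (hA.differentiable (by simp)).differentiableAt hAp]
  exact map_smul (fderiv ℂ A p) _ _

lemma dproj_ne_zero {p : ℂ × (Fin n → ℂ)} (hp : p ∈ upperHalfSpace n) {u : ℂ × (Fin n → ℂ)}
    (hu : u ≠ 0) : D.dproj p u ≠ 0 := by
  obtain ⟨A, B, hA, hB, hBA, hAp⟩ := D.exists_chart_proj_eventuallyEq hp
    (chart_mem_atlas (ℂ × (Fin n → ℂ)) (D.proj p)) (mem_chart_source _ _)
  have hAd := (hA.differentiable (by simp)).differentiableAt (x := p)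
  have hBd := (hB.differentiable (by simp)).differentiableAt (x := A p)
  rw [D.dproj_eq_fderiv hp hAd hAp]
  intro h
  change fderiv ℂ A p u = 0 at h
  have h1 : HasFDerivAt (B ∘ A) (ContinuousLinearMap.id ℂ _) p := by
    refine (hasFDerivAt_id p).congr_of_eventuallyEq ?_
    filter_upwards [(isOpen_upperHalfSpace n).mem_nhds hp] with z hz using hBA z hz
  have h2 := (hBd.hasFDerivAt.comp p hAd.hasFDerivAt).unique h1
  have h3 := congrArg (fun L : (ℂ × (Fin n → ℂ)) →L[ℂ] ℂ × (Fin n → ℂ) ↦ L u) h2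
  simp only [ContinuousLinearMap.comp_apply, h, map_zero, ContinuousLinearMap.id_apply] at h3
  exact hu h3.symm

/-- The chain rule for a map that the projection does not see; it makes the pulled-back form
invariant under deck transformations. -/
lemma dproj_comp {p : ℂ × (Fin n → ℂ)} {A : ℂ × (Fin n → ℂ) → ℂ × (Fin n → ℂ)}
    {A' : (ℂ × (Fin n → ℂ)) →L[ℝ] ℂ × (Fin n → ℂ)} (hA : HasFDerivAt A A' p)
    (hp : A p ∈ upperHalfSpace n) (hAp : ∀ᶠ z in 𝓝 p, D.proj (A z) = D.proj z) :
    D.dproj (A p) ∘L A' = D.dproj p := by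
  have h1 : HasMFDerivAt 𝓘(ℝ, ℂ × (Fin n → ℂ)) 𝓘(ℝ, ℂ × (Fin n → ℂ)) (D.proj ∘ A) p
      (D.dproj (A p) ∘L A') := (D.hasMFDerivAt_proj hp).comp p hA.hasMFDerivAt
  have h2 : D.proj =ᶠ[𝓝 p] D.proj ∘ A := by
    filter_upwards [hAp] with z hz using hz.symm
  exact (h1.congr_of_eventuallyEq h2).mfderiv.symm

variable {D} in
/-- The pullback to `ℍ × ℂⁿ` of the fundamental form of a Hermitian metric on `T_M`. -/
def pullbackForm (g : HermitianMetric (ℂ × (Fin n → ℂ)) D.T) (p : ℂ × (Fin n → ℂ)) :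
    (ℂ × (Fin n → ℂ)) →L[ℝ] (ℂ × (Fin n → ℂ)) →L[ℝ] ℝ :=
  let B : (ℂ × (Fin n → ℂ)) →L[ℝ] (ℂ × (Fin n → ℂ)) →L[ℝ] ℝ := g.inner (D.proj p)
  let J : (ℂ × (Fin n → ℂ)) →L[ℝ] ℂ × (Fin n → ℂ) := complexStructure _ (D.proj p)
  B.bilinearComp (J ∘L D.dproj p) (D.dproj p)

variable {D}
variable (g : HermitianMetric (ℂ × (Fin n → ℂ)) D.T)

lemma pullbackForm_apply (p u v : ℂ × (Fin n → ℂ)) :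
    pullbackForm g p u v = g.fundamentalForm (D.proj p) ![D.dproj p u, D.dproj p v] := rfl

lemma pullbackForm_self (p u : ℂ × (Fin n → ℂ)) : pullbackForm g p u u = 0 := by
  rw [pullbackForm_apply]
  exact (g.fundamentalForm (D.proj p)).map_eq_zero_of_eq _ (i := 0) (j := 1) rfl Fin.zero_ne_one

/-- Moving J to the source makes it a constant operator. Positivity and smoothness then follow from
those of the metric, with no argument about J on `T`. -/
lemma pullbackForm_apply_eq_inner {p : ℂ × (Fin n → ℂ)} (hp : p ∈ upperHalfSpace n)
    (u v : ℂ × (Fin n → ℂ)) : pullbackForm g p u v =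
      g.inner (D.proj p) (D.dproj p (Complex.I • u)) (D.dproj p v) := by
  rw [D.dproj_I_smul hp]
  rfl

lemma pullbackForm_pos {p : ℂ × (Fin n → ℂ)} (hp : p ∈ upperHalfSpace n)
    {u : ℂ × (Fin n → ℂ)} (hu : u ≠ 0) : 0 < pullbackForm g p u (Complex.I • u) := by
  rw [pullbackForm_apply_eq_inner g hp]
  exact g.pos _ _ (D.dproj_ne_zero hp (smul_ne_zero Complex.I_ne_zero hu))

lemma pullbackForm_comp {p q : ℂ × (Fin n → ℂ)} (hpq : D.proj q = D.proj p)
    {A : (ℂ × (Fin n → ℂ)) →L[ℝ] ℂ × (Fin n → ℂ)} (hA : D.dproj q ∘L A = D.dproj p)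
    (u v : ℂ × (Fin n → ℂ)) : pullbackForm g q (A u) (A v) = pullbackForm g p u v := by
  have h1 (w : ℂ × (Fin n → ℂ)) : D.dproj q (A w) = D.dproj p w := by rw [← hA]; rfl
  rw [pullbackForm_apply, pullbackForm_apply, h1, h1, hpq]

end Differential

end EndoPajitnovData

/-! ### Smoothness of the pulled-back form -/

namespace EndoPajitnovData

section Smoothness

set_option maxSynthPendingDepth 3

open Bundle

variable {n : ℕ} {D : EndoPajitnovData n} (g : HermitianMetric (ℂ × (Fin n → ℂ)) D.T)

/-- The section is the tangent map of the projection composed with the constant vector field u. -/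
lemma contMDiffAt_mfderiv_proj {p : ℂ × (Fin n → ℂ)} (hp : p ∈ upperHalfSpace n)
    (u : ℂ × (Fin n → ℂ)) :
    ContMDiffAt 𝓘(ℝ, ℂ × (Fin n → ℂ))
      (𝓘(ℝ, ℂ × (Fin n → ℂ)).prod 𝓘(ℝ, ℂ × (Fin n → ℂ))) ∞
      (fun q ↦ TotalSpace.mk' (ℂ × (Fin n → ℂ))
        (E := (TangentSpace 𝓘(ℝ, ℂ × (Fin n → ℂ)) : D.T → Type _)) (D.proj q) (D.dproj q u)) p := by
  have hopen := isOpen_upperHalfSpace n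
  have h1 : ContMDiffOn 𝓘(ℝ, ℂ × (Fin n → ℂ)) 𝓘(ℝ, ℂ × (Fin n → ℂ)) ω D.proj
      (upperHalfSpace n) := fun q hq ↦ (D.contMDiffAt_proj hq).contMDiffWithinAt
  have h2 := h1.contMDiffOn_tangentMapWithin (m := ∞) (by simp) hopen.uniqueMDiffOn
  have h3 : ContMDiff 𝓘(ℝ, ℂ × (Fin n → ℂ))
      (𝓘(ℝ, ℂ × (Fin n → ℂ)).prod 𝓘(ℝ, ℂ × (Fin n → ℂ))) ∞
      (fun q : ℂ × (Fin n → ℂ) ↦ (⟨q, u⟩ : TangentBundle 𝓘(ℝ, ℂ × (Fin n → ℂ))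
        (ℂ × (Fin n → ℂ)))) := by
    intro q
    rw [contMDiffAt_totalSpace]
    refine ⟨contMDiffAt_id, ?_⟩
    simpa using contMDiffAt_const
  have h4 := (h2 ⟨p, u⟩ hp).contMDiffAt
    ((hopen.preimage (FiberBundle.continuous_proj _ _)).mem_nhds hp)
  refine (h4.comp p (h3 p)).congr_of_eventuallyEq ?_
  filter_upwards [hopen.mem_nhds hp] with q hq
  simp only [Function.comp_apply, tangentMapWithin]
  rw [mfderivWithin_of_isOpen hopen hq]
  rfl

lemma contDiffOn_pullbackForm : ContDiffOn ℝ ∞ (pullbackForm g) (upperHalfSpace n) := by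
  rw [contDiffOn_clm_apply]
  intro u
  rw [contDiffOn_clm_apply]
  intro v p hp
  refine ContDiffAt.contDiffWithinAt ?_
  rw [← contMDiffAt_iff_contDiffAt]
  have h1 : ContMDiffAt 𝓘(ℝ, ℂ × (Fin n → ℂ)) (𝓘(ℝ, ℂ × (Fin n → ℂ)).prod 𝓘(ℝ)) ∞
      (fun q ↦ TotalSpace.mk' ℝ (E := Bundle.Trivial D.T ℝ) (D.proj q)
        (g.inner (D.proj q) (D.dproj q (Complex.I • u)) (D.dproj q v))) p := by
    apply ContMDiffAt.clm_bundle_apply₂ (F₁ := ℂ × (Fin n → ℂ)) (F₂ := ℂ × (Fin n → ℂ))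
    · exact ContMDiffAt.comp p g.contMDiff.contMDiffAt
        ((D.contMDiffAt_proj hp).of_le (by exact_mod_cast le_top))
    · exact contMDiffAt_mfderiv_proj hp _
    · exact contMDiffAt_mfderiv_proj hp _
  simp only [contMDiffAt_totalSpace] at h1
  refine h1.2.congr_of_eventuallyEq ?_
  filter_upwards [(isOpen_upperHalfSpace n).mem_nhds hp] with q hq
  exact pullbackForm_apply_eq_inner g hq u v

end Smoothness

/-! ### Transfer of the locally conformally Kähler condition -/

section Transfer

set_option maxSynthPendingDepth 3

variable {n : ℕ} {D : EndoPajitnovData n} (g : HermitianMetric (ℂ × (Fin n → ℂ)) D.T)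

lemma formInChart_eq {k : ℕ} (η : ∀ x : D.T,
      TangentSpace 𝓘(ℝ, ℂ × (Fin n → ℂ)) x [⋀^Fin k]→L[ℝ] ℝ)
    {e : OpenPartialHomeomorph D.T (ℂ × (Fin n → ℂ))}
    (he : e ∈ atlas (ℂ × (Fin n → ℂ)) D.T) (y : ℂ × (Fin n → ℂ))
    (v : Fin k → ℂ × (Fin n → ℂ)) :
    formInChart η e y v = η (D.proj y) (fun i ↦ D.dproj y (v i)) := by
  have key (f : ℂ × (Fin n → ℂ) → D.T) (hf : ⇑e.symm = f) : formInChart η e y v = η (f y)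
      (fun i ↦ (mfderiv 𝓘(ℝ, ℂ × (Fin n → ℂ)) 𝓘(ℝ, ℂ × (Fin n → ℂ)) f y :
        (ℂ × (Fin n → ℂ)) →L[ℝ] TangentSpace 𝓘(ℝ, ℂ × (Fin n → ℂ)) (f y)) (v i)) := by
    subst hf
    rfl
  exact key D.proj (D.coe_symm_of_mem_atlas he)

/-- The pullback of a locally conformally Kähler form is locally conformally closed. -/
lemma isLeeFormAt_pullbackForm {U : Set D.T} {f : D.T → ℝ} {q : ℂ × (Fin n → ℂ)}
    (hq : q ∈ upperHalfSpace n) (hqU : D.proj q ∈ U) (hU : IsOpen U)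
    (hf : ContMDiffOn 𝓘(ℝ, ℂ × (Fin n → ℂ)) 𝓘(ℝ, ℝ) ∞ f U)
    (hclosed : IsClosedFormOn (fun x ↦ Real.exp (-f x) • g.fundamentalForm x) U) :
    ContDiffAt ℝ ∞ (f ∘ D.proj) q ∧
      IsLeeFormAt (pullbackForm g) q (fderiv ℝ (f ∘ D.proj) q) := by
  have hfd (z : ℂ × (Fin n → ℂ)) (hz : z ∈ upperHalfSpace n) (hzU : D.proj z ∈ U) :
      ContDiffAt ℝ ∞ (f ∘ D.proj) z := by
    rw [← contMDiffAt_iff_contDiffAt]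
    exact (hf.contMDiffAt (hU.mem_nhds hzU)).comp z
      ((D.contMDiffAt_proj hz).of_le (by exact_mod_cast le_top))
  have hWd (z : ℂ × (Fin n → ℂ)) (hz : z ∈ upperHalfSpace n) :
      DifferentiableAt ℝ (pullbackForm g) z :=
    ((contDiffOn_pullbackForm g).differentiableOn (by simp)).differentiableAt
      ((isOpen_upperHalfSpace n).mem_nhds hz)
  have hfdiff (z : ℂ × (Fin n → ℂ)) (hz : z ∈ upperHalfSpace n) (hzU : D.proj z ∈ U) :
      DifferentiableAt ℝ (f ∘ D.proj) z := (hfd z hz hzU).differentiableAt (by simp)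
  refine ⟨hfd q hq hqU, ?_⟩
  set e := chartAt (ℂ × (Fin n → ℂ)) (D.proj q)
  have he : e ∈ atlas (ℂ × (Fin n → ℂ)) D.T := chart_mem_atlas _ _
  have hqe : D.proj q ∈ e.source := mem_chart_source _ _
  obtain ⟨A, -, hA, -, -, hAq⟩ := D.exists_chart_proj_eventuallyEq hq he hqe
  have hAR : ContDiff ℝ ω A := hA.restrict_scalars ℝ
  have hAd (z) : DifferentiableAt ℝ A z := (hAR.differentiable (by simp)).differentiableAt
  have hsymm := D.coe_symm_of_mem_atlas he
  have hAqt : A q ∈ e.target := hAq.self_of_nhds ▸ e.map_source hqe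
  have hAqH : A q ∈ upperHalfSpace n := D.target_subset_of_mem_atlas he hAqt
  have hprojA : ∀ᶠ z in 𝓝 q, D.proj (A z) = D.proj z := by
    filter_upwards [hAq, (D.continuousAt_proj hq).eventually_mem
      (e.open_source.mem_nhds hqe)] with z hz hze
    rw [← hz]
    exact (congrFun hsymm _).symm.trans (e.left_inv hze)
  have hprojAq : D.proj (A q) = D.proj q := hprojA.self_of_nhds
  let η : ∀ x : D.T, TangentSpace 𝓘(ℝ, ℂ × (Fin n → ℂ)) x [⋀^Fin 2]→L[ℝ] ℝ :=
    fun x ↦ Real.exp (-f x) • g.fundamentalForm x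
  let Φ := formInChart η e
  let K := fun y ↦ Real.exp (-(f ∘ D.proj) y) • pullbackForm g y
  have hΦ (y) (v : Fin 2 → ℂ × (Fin n → ℂ)) : Φ y v = K y (v 0) (v 1) :=
    formInChart_eq η he y v
  have hKd (z : ℂ × (Fin n → ℂ)) (hz : z ∈ upperHalfSpace n) (hzU : D.proj z ∈ U) :
      DifferentiableAt ℝ K z := ((hfdiff z hz hzU).neg.exp).smul (hWd z hz)
  have hext : extDeriv Φ (A q) = 0 :=
    hclosed e he (A q) hAqt ((congrFun hsymm _).symm ▸ hprojAq.symm ▸ hqU)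
  -- Closedness is known only on the target of `e`, which contains `A q` but perhaps not `q`. The
  -- deck transformation `A` pulls `Φ` back to itself near `q`, which carries the vanishing of its
  -- exterior derivative from `A q` to `q`.
  have hpull : Φ =ᶠ[𝓝 q] fun z ↦ (Φ (A z)).compContinuousLinearMap (fderiv ℝ A z) := by
    filter_upwards [hprojA.eventually_nhds, hA.continuous.continuousAt.eventually_mem
      ((isOpen_upperHalfSpace n).mem_nhds hAqH)] with z hz hzH
    have h1 := D.dproj_comp (hAd z).hasFDerivAt hzH hz
    ext v
    have h2 := pullbackForm_comp g hz.self_of_nhds h1 (v 0) (v 1)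
    rw [hΦ, ContinuousAlternatingMap.compContinuousLinearMap_apply, hΦ]
    simp only [K, smul_apply, Function.comp_apply, hz.self_of_nhds]
    rw [h2]
  have hextq : extDeriv Φ q = 0 := by
    rw [hpull.extDeriv_eq, extDeriv_pullback (r := ω)
      (differentiableAt_of_apply_eq hΦ (hKd _ hAqH (hprojAq ▸ hqU))) hAR.contDiffAt (by simp), hext]
    rfl
  exact (isLeeFormAt_exp_neg_smul_zero_iff (hWd q hq) (hfdiff q hq hqU)).1
    (isLeeFormAt_zero_of_extDeriv_eq_zero hΦ (hKd q hq hqU) hextq)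

/-- An Endo–Pajitnov manifold of dimension at least three admits no locally conformally Kähler
metric. -/
theorem not_isLocallyConformallyKahler (hn : 1 < n) : ¬ g.IsLocallyConformallyKahler := by
  intro hg
  have hopen := isOpen_upperHalfSpace n
  refine D.false_of_invariant_locally_conformal hn (W := pullbackForm g)
    ((contDiffOn_pullbackForm g).of_le (by exact_mod_cast le_top))
    (fun p _ u ↦ pullbackForm_self g p u) (fun p hp u hu ↦ pullbackForm_pos g hp hu) ?_ ?_ ?_
  · intro p hp c u v
    refine pullbackForm_comp g (D.proj_add_latticeMap hp c)
      (A := ContinuousLinearMap.id ℝ _) ?_ u v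
    refine D.dproj_comp (A := fun q ↦ q + D.latticeMap fun i ↦ (c i : ℝ))
      ((hasFDerivAt_id p).add_const _) (D.add_latticeMap_mem hp _) ?_
    filter_upwards [hopen.mem_nhds hp] with z hz using D.proj_add_latticeMap hz c
  · intro p hp u v
    refine pullbackForm_comp g (D.proj_dilation hp) ?_ u v
    refine D.dproj_comp D.dilation.hasFDerivAt (D.dilation_mem hp) ?_
    filter_upwards [hopen.mem_nhds hp] with z hz using D.proj_dilation hz
  · intro p hp
    obtain ⟨U, hU, hpU, f, hf, hclosed⟩ := hg (D.proj p)
    refine ⟨f ∘ D.proj, (isLeeFormAt_pullbackForm g hp hpU hU hf hclosed).1, ?_⟩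
    filter_upwards [hopen.mem_nhds hp, (D.continuousAt_proj hp).eventually_mem
      (hU.mem_nhds hpU)] with q hq hqU
    exact (isLeeFormAt_pullbackForm g hq hqU hU hf hclosed).2

end Transfer

end EndoPajitnovData

end

theorem mainTheorem5 (n : ℕ) (hn : 1 < n) (D : EndoPajitnovData n) :
    ¬ ∃ g : HermitianMetric (ℂ × (Fin n → ℂ)) D.T, g.IsLocallyConformallyKahler := by
  rintro ⟨g, hg⟩
  exact EndoPajitnovData.not_isLocallyConformallyKahler g hn hg
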